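/- **Setting.** A slotted network has nodes $\Omega=\{0,1,\dots,N\}$, with destination $0$. If node $i$ transmits, the set $S$ of nodes that then have the packet has probability $P(S|i)$, where $i\in S$ whenever $P(S|i)>0$. We write $i\to j$ if $P(S|i)>0$ for some $S\ni j$. In slot $t$, $A_k(t)\in\mathbb N$ packets arrive at node $k\ge 1$, and $S_i(t)\ni i$ is the set of nodes that receive the transmission of $i$, with law $P(\cdot|i)$. The pairs $(A(t),S(t))$ are independent over $t$, the $A(t)$ are identically distributed and bounded, and $\lambda_k=\mathbb E A_k(t)$. The initial backlogs are independent of all this and have finite second moments. A routing policy chooses $\mu_{ij}(t)\in\{0,1\}$ with $\mu_{ij}(t)\le \mathbf 1_{\{j\in S_i(t)\}}$ and $\sum_j\mu_{ij}(t)\le 1$, as a function of the backlogs and sets $S_i$ up to time $t$ and the decisions before $t$. Backlogs satisfy $Q_0(t)=0$ and, for $k\ge 1$, $$Q_k(t+1)=\Big[Q_k(t)-\sum_j\mu_{kj}(t)\Big]^+ +\sum_j\mu_{jk}(t)\mathbf 1_{\{Q_j(t)\ge\mu_{jk}(t)\}}+A_k(t).$$ The policy stabilizes the network if $\limsup_{T\to\infty}\frac1T\sum_{t<T}\mathbb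 E\,Q_i(t)<\infty$ for all $i$. The stability region is the set of all $\lambda\in\mathbb R_+^N$ for which some routing policy stabilizes the network (for some arrival process with rates $\lambda$). A policy is throughput optimal if it stabilizes the network for every arrival process whose rate vector lies in the interior of the stability region relative to $\mathbb R^N_+$ (in particular, in its interior in $\mathbb R^N$). **Rank orderings.** A rank ordering $R=(C_1,\dots,C_M)$ is an ordered partition of $\{1,\dots,N\}$ into non-empty classes; nodes in earlier classes have lower rank, and the destination has the lowest rank of all. Put $C^i=C_1\cup\dots\cup C_i$ and $Q_C=\sum_{k\in C}Q_k$. A one-step refinement of $R$ splits one class $C_i$ into two non-empty consecutive classes; $R'$ is adjacent to $R$ if one of the two is a one-step refinement of the other. For $f:\{0,1,\dots\}\times\{1,2,\dots\}\to\mathbb R$ let $\Lambda_f(Q,R,n)=\sum_{i=1}^n f(|C^{i-1}|,|C_i|)\,Q_{C_i}$, and let $m(R,R')$ be the index of the first class in which $R$ and $R'$ differ. Write $R<_Q R'$ if, with $m=m(R,R')$, either $\Lambda_f(Q,R,m)<\Lambda_f(Q,R',m)$, or these are equal and $R$ is a one-step refinement of $R'$. Let $D_f(R)$ be the set of $Q\in\mathbb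 R_+^N$ with $R<_Q R'$ for all $R'$ adjacent to $R$. A rank ordering is path-connected if each node $i\ge1$ has a path $i\to j_1\to\dots\to j_l\to 0$ with distinct $j_1,\dots,j_l$ of rank at most that of $i$; $D_f^c(R)$ is defined like $D_f(R)$ with only the path-connected $R'$ adjacent to $R$. The network is connected if every node has a path to $0$. **Policies.** An $f$-policy is a routing policy under which, in each slot $t$, every node $i\geq 1$ hands its packet over to a node of lowest rank in $S_i(t)$ (possibly $i$ itself), ties being broken arbitrarily, with respect to a rank ordering $R(t)$ such that $Q(t)\in D_f(R(t))$. A path-connected $f$-policy is the same with $R(t)$ path-connected and $Q(t)\in D^c_f(R(t))$. **Theorem.** Let $f(m,n)>0$ for all integers $m\ge 0$, $n\ge1$, and suppose that for all $m\ge0$ and $n_1,n_2\ge1$ $$\text{(C1)}\quad \frac1{f(m,n_1+n_2)}=\frac1{f(m,n_1)}+\frac1{f(m+n_1,n_2)},\qquad \text{(C2)}\quad f(m,n_1)\ge f(m+n_1,n_2).$$ Then every $Q\in\mathbb R_+^N$ lies in $D_f(R)$ for some rank ordering $R$, and every $f$-policy is throughput optimal. If the network is connected, every $Q\in\mathbb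 R_+^N$ lies in $D_f^c(R)$ for some path-connected $R$; and every path-connected $f$-policy is throughput optimal. -/

import Mathlib

open MeasureTheory ProbabilityTheory Filter Finset
open scoped NNReal ENNReal

universe u

/-! ### The network -/

/-- A network with nodes `0, 1, …, N`, node `0` being the destination, given by its local
broadcast model: `prob i S` is the probability `P(S|i)` that `S` is exactly the set of nodes that
have a packet after it has been transmitted by `i`. The transmitter always has the packet. -/
structure Network (N : ℕ) where
  prob : Fin (N + 1) → PMF (Finset (Fin (N + 1)))
  self_mem : ∀ i S, 0 < prob i S → i ∈ S

namespace Network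

variable {N : ℕ}

/-- Node `i` reaches node `j`. -/
def Reaches (net : Network N) (i j : Fin (N + 1)) : Prop :=
  ∃ S, j ∈ S ∧ 0 < net.prob i S

/-- Each node has a path `i → i₁ → ⋯ → iₗ → 0` to the destination. -/
def Connected (net : Network N) : Prop :=
  ∀ i : Fin (N + 1), i ≠ 0 → ∃ l : List (Fin (N + 1)), List.IsChain net.Reaches (i :: (l ++ [0]))

end Network

/-! ### Queues, routing policies, stability -/

/-- A run of the network at arrival rate vector `lam` under some routing policy, on the probability
space `(Ω, P)`. Nodes `1, …, N` are the nodes `k.succ`, `k : Fin N`. Backlogs are counted in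
packets. -/
structure Run {N : ℕ} (net : Network N) (lam : Fin N → ℝ≥0)
    (Ω : Type u) [MeasurableSpace Ω] (P : Measure Ω) where
  /-- `A t ω k`: number of packets that arrive exogenously during slot `t` at node `k.succ` -/
  A : ℕ → Ω → Fin N → ℕ
  /-- `S t ω i`: set of potential forwarders of node `i` in slot `t` -/
  S : ℕ → Ω → Fin (N + 1) → Finset (Fin (N + 1))
  /-- `mu t ω i j`: number of packets whose responsibility is shifted from `i` to `j` -/
  mu : ℕ → Ω → Fin (N + 1) → Fin (N + 1) → ℕ
  /-- `Q t ω i`: backlog of node `i` at the beginning of slot `t` -/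
  Q : ℕ → Ω → Fin (N + 1) → ℕ
  measurable_A : ∀ t, Measurable (A t)
  measurable_S : ∀ t, Measurable (S t)
  measurable_Q_zero : Measurable (Q 0)
  /-- what happens in different slots is independent (within a slot, any dependence between the
  nodes, and between arrivals and channels, is allowed) -/
  indep : iIndepFun (fun t ω => (A t ω, S t ω)) P
  /-- the initial backlog is independent of arrivals and channels -/
  indep_init : IndepFun (Q 0) (fun ω t => (A t ω, S t ω)) P
  /-- arrivals are identically distributed over time -/
  identDistrib_A : ∀ t, IdentDistrib (A t) (A 0) P P
  /-- arrivals are bounded -/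
  bounded_A : ∃ Amax : ℕ, ∀ t ω k, A t ω k ≤ Amax
  /-- the arrival rates are `lam` -/
  rate_A : ∀ k, ∫ ω, (A 0 ω k : ℝ) ∂P = lam k
  /-- the channels follow the local broadcast model -/
  law_S : ∀ t i s, P {ω | S t ω i = s} = net.prob i s
  self_mem_S : ∀ t ω i, i ∈ S t ω i
  /-- the initial backlog has finite second moments (for example, it is deterministic) -/
  memLp_Q_zero : ∀ i, MemLp (fun ω => (Q 0 ω i : ℝ)) 2 P
  /-- a node hands over a packet only to one of its potential forwarders -/
  mu_le : ∀ t ω i j, mu t ω i j ≤ if j ∈ S t ω i then 1 else 0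
  /-- a node hands over at most one packet per slot -/
  sum_mu_le : ∀ t ω i, ∑ j, mu t ω i j ≤ 1
  /-- decisions are determined by past and present backlogs and forwarder sets and by past
  decisions -/
  adapted_mu : ∀ t,
    Measurable[(⨆ s ∈ Set.Iic t, MeasurableSpace.comap (fun ω => (Q s ω, S s ω)) inferInstance) ⊔
      (⨆ s ∈ Set.Iio t, MeasurableSpace.comap (mu s) inferInstance)] (mu t)
  /-- data delivered to the destination exit the network -/
  Q_dest : ∀ t ω, Q t ω 0 = 0
  /-- the queue dynamics (subtraction of natural numbers is truncated at `0`, as it should be) -/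
  Q_succ : ∀ t ω (k : Fin N),
    Q (t + 1) ω k.succ = (Q t ω k.succ - ∑ j, mu t ω k.succ j)
      + (∑ j, mu t ω j k.succ * if mu t ω j k.succ ≤ Q t ω j then 1 else 0) + A t ω k

/-- The network is stable: the time average of the expected backlog of every node stays finite. -/
def Run.Stable {N : ℕ} {net : Network N} {lam : Fin N → ℝ≥0} {Ω : Type u} [MeasurableSpace Ω]
    {P : Measure Ω} (run : Run net lam Ω P) : Prop :=
  ∀ i, limsup (fun T : ℕ => (∑ t ∈ range T, ∫⁻ ω, (run.Q t ω i : ℝ≥0∞) ∂P) / (T : ℝ≥0∞)) atTop < ⊤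

/-- The stability region: all arrival rate vectors for which some routing policy stabilizes the
network. -/
def stabilityRegion {N : ℕ} (net : Network N) : Set (Fin N → ℝ≥0) :=
  {lam | ∃ (Ω : Type) (_ : MeasurableSpace Ω) (P : Measure Ω) (_ : IsProbabilityMeasure P)
    (run : Run net lam Ω P), run.Stable}

/-- A time-invariant rule for routing decisions: `rule q s m` says that the decisions `m i j` are
allowed when the backlogs are `q i` and the sets of potential forwarders are `s i`. -/
abbrev DecisionRule (N : ℕ) : Type :=
  (Fin (N + 1) → ℕ) → (Fin (N + 1) → Finset (Fin (N + 1))) → (Fin (N + 1) → Fin (N + 1) → ℕ) → Prop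

/-- The routing decisions of the run obey the rule in every slot. -/
def Run.Follows {N : ℕ} {net : Network N} {lam : Fin N → ℝ≥0} {Ω : Type u} [MeasurableSpace Ω]
    {P : Measure Ω} (run : Run net lam Ω P) (rule : DecisionRule N) : Prop :=
  ∀ t ω, rule (run.Q t ω) (run.S t ω) (run.mu t ω)

/-- Every routing policy that obeys the rule stabilizes the network for all arrival rate vectors in
the interior of the stability region. -/
def ThroughputOptimal {N : ℕ} (net : Network N) (rule : DecisionRule N) : Prop :=
  ∀ lam ∈ interior (stabilityRegion net),
    ∀ (Ω : Type u) [MeasurableSpace Ω] (P : Measure Ω) [IsProbabilityMeasure P]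
      (run : Run net lam Ω P), run.Follows rule → run.Stable

/-! ### Rank orderings -/

/-- A rank ordering `(C₁, …, C_M)`: an ordered partition of the nodes other than the destination
into non-empty ranking classes. The element `k : Fin N` stands for node `k.succ`. -/
structure RankOrdering (N : ℕ) where
  classes : List (Finset (Fin N))
  nonempty : ∀ C ∈ classes, C.Nonempty
  disjoint : classes.Pairwise Disjoint
  cover : ∀ k, ∃ C ∈ classes, k ∈ C

namespace RankOrdering

variable {N : ℕ}

/-- The ranking class `C_i`, `i = 1, …, M` (and `∅` for any other index). -/
def cls (R : RankOrdering N) (i : ℕ) : Finset (Fin N) := (∅ :: R.classes).getD i ∅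

/-- `C^i = C₁ ∪ ⋯ ∪ C_i`. -/
def cum (R : RankOrdering N) (i : ℕ) : Finset (Fin N) := (Icc 1 i).biUnion R.cls

/-- The rank of a node: the index of its ranking class; the destination ranks below all others. So
`a ≺ b` is `R.rank a < R.rank b`, and `a ⪯ b` is `R.rank a ≤ R.rank b`. -/
noncomputable def rank (R : RankOrdering N) : Fin (N + 1) → ℕ :=
  Fin.cases 0 (fun k => sInf {i | k ∈ R.cls i})

/-- The index of the first ranking class in which `R` and `R'` differ. -/
noncomputable def mismatch (R R' : RankOrdering N) : ℕ := sInf {i | R.cls i ≠ R'.cls i}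

/-- `R'` is a one-step refinement of `R`: one class of `R` is split into two. -/
def IsOneStepRefinement (R' R : RankOrdering N) : Prop :=
  ∃ (l₁ l₂ : List (Finset (Fin N))) (A B : Finset (Fin N)),
    R.classes = l₁ ++ (A ∪ B) :: l₂ ∧ R'.classes = l₁ ++ A :: B :: l₂

/-- Adjacency: `R'` is a one-step refinement or a one-step confinement of `R`. -/
def Adjacent (R R' : RankOrdering N) : Prop :=
  R'.IsOneStepRefinement R ∨ R.IsOneStepRefinement R'

/-- The penalty function `Λ_f(Q, R, n)`. -/
def penalty (f : ℕ → ℕ → ℝ) (Q : Fin N → ℝ) (R : RankOrdering N) (n : ℕ) : ℝ :=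
  ∑ i ∈ Icc 1 n, f (#(R.cum (i - 1))) (#(R.cls i)) * ∑ k ∈ R.cls i, Q k

/-- `R` penalizes `Q` less than `R'`. -/
def PenalizesLess (f : ℕ → ℕ → ℝ) (Q : Fin N → ℝ) (R R' : RankOrdering N) : Prop :=
  penalty f Q R (R.mismatch R') < penalty f Q R' (R.mismatch R') ∨
    (penalty f Q R (R.mismatch R') = penalty f Q R' (R.mismatch R') ∧ R.IsOneStepRefinement R')

/-- The cone `D_f(R)`. -/
def cone (f : ℕ → ℕ → ℝ) (R : RankOrdering N) : Set (Fin N → ℝ) :=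
  {Q | (∀ k, 0 ≤ Q k) ∧ ∀ R', R.Adjacent R' → PenalizesLess f Q R R'}

/-- Each node has a path to the destination through nodes of lower or the same rank. -/
def PathConnected (net : Network N) (R : RankOrdering N) : Prop :=
  ∀ i : Fin (N + 1), i ≠ 0 → ∃ l : List (Fin (N + 1)), l.Nodup ∧
    List.IsChain net.Reaches (i :: (l ++ [0])) ∧ ∀ j ∈ l, R.rank j ≤ R.rank i

/-- The cone `D^c_f(R)`: only path-connected adjacent rank orderings compete with `R`. -/
def pathCone (net : Network N) (f : ℕ → ℕ → ℝ) (R : RankOrdering N) : Set (Fin N → ℝ) :=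
  {Q | (∀ k, 0 ≤ Q k) ∧
    ∀ R' : RankOrdering N, R'.PathConnected net → R.Adjacent R' → PenalizesLess f Q R R'}

/-- Priority-based routing with respect to `R`: each node selects, among its potential forwarders
`s i`, one of lowest rank. -/
def IsPriorityDecision (R : RankOrdering N) (s : Fin (N + 1) → Finset (Fin (N + 1)))
    (m : Fin (N + 1) → Fin (N + 1) → ℕ) : Prop :=
  ∀ i, i ≠ 0 → ∑ j, m i j = 1 ∧ ∀ j, m i j = 1 → j ∈ s i ∧ ∀ k ∈ s i, R.rank j ≤ R.rank k

end RankOrdering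

/-! ### The two policies -/

/-- The `f`-policy: priority-based routing with respect to a rank ordering whose cone contains the
current backlog vector. -/
def fPolicy {N : ℕ} (f : ℕ → ℕ → ℝ) : DecisionRule N := fun q s m =>
  ∃ R : RankOrdering N, (fun k : Fin N => (q k.succ : ℝ)) ∈ R.cone f ∧ R.IsPriorityDecision s m

/-- The path-connected `f`-policy: the same with path-connected rank orderings only. -/
def pathConnectedFPolicy {N : ℕ} (net : Network N) (f : ℕ → ℕ → ℝ) : DecisionRule N := fun q s m =>
  ∃ R : RankOrdering N, R.PathConnected net ∧
    (fun k : Fin N => (q k.succ : ℝ)) ∈ R.pathCone net f ∧ R.IsPriorityDecision s m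

/-! ### Slopes: minimizers of `Q(A) - c G(|A|)` over a union-closed family -/

/-! By (C1), f(m,n) = 1/(G(m+n) - G(m)) with G = `cumWeight f`, and (C2) says that G at least
doubles in every step. View a rank ordering as the chain of its sets C^i. Then f(|C^{i-1}|,|C_i|)
Q_{C_i} is the slope of the segment from (G(|C^{i-1}|), Q(C^{i-1})) to (G(|C^i|), Q(C^i)). Competing
against confinements means that these slopes do not decrease along the chain; competing against
refinements means that no admissible set strictly between two neighbours of the chain lies on or
below their chord. Because G is superadditive (`excess_union_le`), these local conditions are
global: giving each node the slope y of its class, the level sets {y ≤ c} minimize Q(A) - c G(|A|)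
over all admissible A (`isSlope_of_chain`). Hence y depends on Q alone (`IsSlope.unique`). The
admissible sets F are all sets for the `f`-policy, and the sets with internal paths to the
destination for the path-connected one; closure under unions suffices. A suitable rank ordering is
found by minimizing the area below the polygon (`exists_mem_familyCone`).

For fixed c, `gain` is a maximum of functions affine in Q, with derivative 1_{c < y_k} in Q_k away
from ties. Integrating over c gives a Lyapunov function with gradient y. Ties are rare enough for a
quadratic remainder (`lyapunov_le_add`), so with bounded increments the drift is the inner product
of y with the increment, up to a constant.

Since y is monotone in rank, priority routing drains y·Q as fast as the channels permit. Only nodes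
with empty queues might fall short, but no node they reach has a smaller y (`IsSlope.le_of_insert`).
Stabilizable rates obey y·λ ≤ `capacity` (`sum_mul_le_capacity`); applied to λ + ε this gives drift
at most B - ε ∑ y_k. As y_k dominates a multiple of Q_k (`IsSlope.le_mul`), summing over time bounds
the backlogs (`stable_of_priority`). -/

/-- A strictly increasing sequence starting at `0` that at least doubles in every step. -/
structure Doubling (G : ℕ → ℝ) : Prop where
  zero : G 0 = 0
  strictMono : StrictMono G
  two_mul_le : ∀ a b, a < b → 2 * G a ≤ G b

namespace Doubling

variable {G : ℕ → ℝ} (hG : Doubling G)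
include hG

theorem one_pos : 0 < G 1 := by
  have := hG.strictMono Nat.zero_lt_one
  rwa [hG.zero] at this

theorem nonneg (n : ℕ) : 0 ≤ G n := by
  have := hG.strictMono.monotone (Nat.zero_le n)
  rwa [hG.zero] at this

/-- Doubling makes the increment at least G(a), hence at least G(1) unless a = 0. This uniform lower
bound on increments controls slopes and the lengths of tie intervals. -/
theorem gap {a b : ℕ} (h : a < b) : G 1 ≤ G b - G a := by
  rcases Nat.eq_zero_or_pos a with rfl | ha
  · rw [hG.zero, sub_zero]
    exact hG.strictMono.monotone h
  · have h1 := hG.two_mul_le a b h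
    have h2 := hG.strictMono.monotone ha
    linarith

theorem superadditive {a b c : ℕ} (h₁ : a < c) (h₂ : b < c) : G a + G b ≤ G c := by
  rcases le_total a b with h | h
  · have := hG.strictMono.monotone h
    have := hG.two_mul_le b c h₂
    linarith
  · have := hG.strictMono.monotone h
    have := hG.two_mul_le a c h₁
    linarith

end Doubling

/-- A union-closed family of sets with smallest element `∅` and largest element `univ`. -/
structure UnionFamily {ι : Type*} [Fintype ι] [DecidableEq ι] (F : Finset ι → Prop) : Prop where
  empty : F ∅
  univ : F Finset.univ
  union : ∀ A B, F A → F B → F (A ∪ B)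

section Slopes

variable {ι : Type*} [Fintype ι] [DecidableEq ι]

/-- `Q(A) - c G(|A|)`. -/
def excess (G : ℕ → ℝ) (Q : ι → ℝ) (c : ℝ) (A : Finset ι) : ℝ := ∑ k ∈ A, Q k - c * G (#A)

/-- The level set `{y ≤ c}`. -/
noncomputable def levelSet (y : ι → ℝ) (c : ℝ) : Finset ι := {k | y k ≤ c}

omit [DecidableEq ι] in
@[simp] theorem mem_levelSet {y : ι → ℝ} {c : ℝ} {k : ι} : k ∈ levelSet y c ↔ y k ≤ c := by
  simp [levelSet]

omit [Fintype ι] [DecidableEq ι] in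
theorem excess_empty {G : ℕ → ℝ} (hG : Doubling G) (Q : ι → ℝ) (c : ℝ) : excess G Q c ∅ = 0 := by
  simp [excess, hG.zero]

omit [Fintype ι] in
-- Incomparable sets are both smaller than their union, so superadditivity of G applies. The
-- intersection, which may fall outside the family, enters only through Q(A ∩ B) ≥ 0.
theorem excess_union_le {G : ℕ → ℝ} (hG : Doubling G) {Q : ι → ℝ} (hQ : ∀ k, 0 ≤ Q k) {c : ℝ}
    (hc : 0 ≤ c) {A B : Finset ι} (hAB : ¬ A ⊆ B) (hBA : ¬ B ⊆ A) :
    excess G Q c (A ∪ B) ≤ excess G Q c A + excess G Q c B := by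
  have h1 : #A < #(A ∪ B) := card_lt_card
    ⟨subset_union_left, fun h => hBA (subset_union_right.trans h)⟩
  have h2 : #B < #(A ∪ B) := card_lt_card
    ⟨subset_union_right, fun h => hAB (subset_union_left.trans h)⟩
  have h3 := mul_le_mul_of_nonneg_left (hG.superadditive h1 h2) hc
  have h4 := sum_union_inter (s₁ := A) (s₂ := B) (f := Q)
  have h5 : 0 ≤ ∑ k ∈ A ∩ B, Q k := sum_nonneg fun k _ => hQ k
  unfold excess
  linarith

/-- The sets `{y ≤ c}` belong to the family `F` and minimize `Q(A) - c G(|A|)` over it. -/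
structure IsSlope (F : Finset ι → Prop) (G : ℕ → ℝ) (Q y : ι → ℝ) : Prop where
  nonneg : ∀ k, 0 ≤ y k
  mem : ∀ c, 0 ≤ c → F (levelSet y c)
  min : ∀ c, 0 ≤ c → ∀ B, F B → excess G Q c (levelSet y c) ≤ excess G Q c B

namespace IsSlope

variable {F : Finset ι → Prop} {G : ℕ → ℝ} {Q y : ι → ℝ}

/-- Compare the level set at c = y k with ∅. This later converts a drift of order -∑ y into one of
order -∑ Q. -/
theorem le_mul (hG : Doubling G) (hF : UnionFamily F) (hQ : ∀ k, 0 ≤ Q k)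
    (h : IsSlope F G Q y) (k : ι) : Q k ≤ G (Fintype.card ι) * y k := by
  have h1 := h.min (y k) (h.nonneg k) ∅ hF.empty
  rw [excess_empty hG, excess] at h1
  have h2 : Q k ≤ ∑ j ∈ levelSet y (y k), Q j :=
    single_le_sum (fun j _ => hQ j) (by simp)
  have h3 : G (#(levelSet y (y k))) ≤ G (Fintype.card ι) :=
    hG.strictMono.monotone (card_le_univ _)
  have h4 := mul_le_mul_of_nonneg_left h3 (h.nonneg k)
  linarith

theorem le_div (hG : Doubling G) (hF : UnionFamily F) (hQ : ∀ k, 0 ≤ Q k)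
    (h : IsSlope F G Q y) (k : ι) : y k ≤ (∑ j, Q j) / G 1 := by
  refine le_of_forall_gt fun c hc => ?_
  have hs : 0 ≤ ∑ j, Q j := sum_nonneg fun j _ => hQ j
  have hg := hG.one_pos
  have hc0 : 0 ≤ (∑ j, Q j) / G 1 := by positivity
  by_contra! hk
  have hk' : k ∉ levelSet y ((((∑ j, Q j) / G 1) + c) / 2) := by
    simp only [mem_levelSet, not_le]; linarith
  -- At this parameter `k` is still missing from the level set, so passing to `univ` gains at least
  -- d G(1) > ∑ Q, contradicting minimality.
  set d := (((∑ j, Q j) / G 1) + c) / 2 with hd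
  have hd1 : (∑ j, Q j) / G 1 < d := by linarith
  have h1 := h.min d (by linarith) Finset.univ hF.univ
  have h2 : #(levelSet y d) < #(Finset.univ : Finset ι) :=
    card_lt_card (ssubset_univ_iff.2 fun e => hk' (e ▸ mem_univ k))
  have h3 := hG.gap h2
  have h4 : 0 ≤ ∑ j ∈ levelSet y d, Q j := sum_nonneg fun j _ => hQ j
  have h5 := mul_le_mul_of_nonneg_left h3 (hc0.trans hd1.le)
  rw [div_lt_iff₀ hg] at hd1
  unfold excess at h1
  linarith

/-- A node with an empty queue that can be added to a member of `F` containing `j` has a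
slope that is at most that of `j`. -/
theorem le_of_insert (hG : Doubling G) (h : IsSlope F G Q y) {k : ι} (hk : Q k = 0) {b : ℝ}
    (hb : 0 ≤ b) (hins : ∀ c, b ≤ c → F (insert k (levelSet y c))) : y k ≤ b := by
  by_contra! hlt
  -- At a parameter midway between `b` and `y k`, inserting `k` leaves Q(A) unchanged and increases
  -- G(|A|), so the level set would not be a minimizer.
  have hc : 0 < (b + y k) / 2 := by linarith
  have hk' : k ∉ levelSet y ((b + y k) / 2) := by
    simp only [mem_levelSet, not_le]; linarith
  have h1 := h.min _ hc.le _ (hins ((b + y k) / 2) (by linarith))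
  unfold excess at h1
  rw [sum_insert hk', hk, card_insert_of_notMem hk'] at h1
  have h2 := hG.gap (Nat.lt_succ_self #(levelSet y ((b + y k) / 2)))
  have h3 := hG.one_pos
  have h4 : 0 < ((b + y k) / 2) * (G (#(levelSet y ((b + y k) / 2)) + 1) -
    G (#(levelSet y ((b + y k) / 2)))) := mul_pos hc (by simp only [Nat.succ_eq_add_one] at h2; linarith)
  linarith

/-- Near ties between two members of `F` of equal size imply near ties with `∅`. -/
theorem exists_near_tie (hG : Doubling G) (hF : UnionFamily F) (hQ : ∀ k, 0 ≤ Q k)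
    (h : IsSlope F G Q y) {c δ : ℝ} (hc : 0 ≤ c) {B : Finset ι} (hB : F B)
    (hne : B ≠ levelSet y c) (hδ : excess G Q c B ≤ excess G Q c (levelSet y c) + δ) :
    ∃ X Y : Finset ι, #X < #Y ∧ |excess G Q c Y - excess G Q c X| ≤ δ := by
  set A := levelSet y c
  have hA : F A := h.mem c hc
  have h1 := h.min c hc B hB
  rcases lt_trichotomy (#A) (#B) with hlt | heq | hgt
  · exact ⟨A, B, hlt, abs_le.2 ⟨by linarith, by linarith⟩⟩
  -- Distinct sets of equal size are incomparable. Minimality of A against A ∪ B then forces the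
  -- excess of B to be nonnegative, so that of A lies in [-δ, 0]: A nearly ties with ∅.
  · have hAB : ¬ A ⊆ B := fun hs => hne (eq_of_subset_of_card_le hs heq.ge).symm
    have hBA : ¬ B ⊆ A := fun hs => hne (eq_of_subset_of_card_le hs heq.le)
    have h2 := excess_union_le hG hQ hc hAB hBA
    have h3 := h.min c hc _ (hF.union _ _ hA hB)
    have h4 := h.min c hc _ hF.empty
    rw [excess_empty hG] at h4
    refine ⟨∅, A, ?_, ?_⟩
    · rw [card_empty, card_pos, nonempty_iff_ne_empty]
      intro he
      exact hAB (he ▸ empty_subset _)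
    · rw [excess_empty hG]
      exact abs_le.2 ⟨by linarith, by linarith⟩
  · exact ⟨B, A, hgt, abs_le.2 ⟨by linarith, by linarith⟩⟩

/-- Sets of different sizes tie for at most one c, so only finitely many c are exceptional. At any
other c ≥ 0 the minimizer is unique, and two slopes differing at `k` would have different level sets
at some generic c between their values. -/
theorem unique (hG : Doubling G) (hF : UnionFamily F) (hQ : ∀ k, 0 ≤ Q k) {y' : ι → ℝ}
    (h : IsSlope F G Q y) (h' : IsSlope F G Q y') : y = y' := by
  suffices H : ∀ z z' : ι → ℝ, IsSlope F G Q z → IsSlope F G Q z' → ∀ k, z' k ≤ z k from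
    funext fun k => le_antisymm (H y' y h' h k) (H y y' h h' k)
  intro z z' hz hz' k
  set bad : Set ℝ := ⋃ p : Finset ι × Finset ι,
    {c | #p.1 < #p.2 ∧ excess G Q c p.2 = excess G Q c p.1} with hbad
  have hfin : bad.Finite := by
    refine Set.finite_iUnion fun p => Set.Subsingleton.finite ?_
    rintro c ⟨hp, hc⟩ d ⟨-, hd⟩
    have hg : G (#p.2) - G (#p.1) ≠ 0 := by
      have := hG.gap hp
      have := hG.one_pos
      intro h0; linarith
    unfold excess at hc hd
    apply mul_right_cancel₀ hg
    linarith
  by_contra! hlt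
  obtain ⟨c, hc, hcb⟩ := ((Set.Ioo_infinite hlt).sdiff hfin).nonempty
  have hc0 : 0 ≤ c := (hz.nonneg k).trans hc.1.le
  by_cases he : levelSet z' c = levelSet z c
  · have : k ∈ levelSet z' c := by rw [he]; simpa using hc.1.le
    rw [mem_levelSet] at this
    exact absurd hc.2 (not_lt.2 this)
  · obtain ⟨X, Y, hXY, ht⟩ := hz.exists_near_tie hG hF hQ hc0 (hz'.mem c hc0) he (δ := 0)
      (by rw [add_zero]; exact hz'.min c hc0 _ (hz.mem c hc0))
    refine hcb (Set.mem_iUnion.2 ⟨(X, Y), hXY, ?_⟩)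
    have := abs_nonpos_iff.1 ht
    linarith

end IsSlope

/-- A chain of sets with increasing slopes, no member of `F` between two neighbours in the chain
lying below the chord, is the chain of level sets of a slope. -/
theorem isSlope_of_chain {F : Finset ι → Prop} {G : ℕ → ℝ} {Q : ι → ℝ} (hG : Doubling G)
    (hF : UnionFamily F) (hQ : ∀ k, 0 ≤ Q k) {n : ℕ} {C : ℕ → Finset ι} {s : ℕ → ℝ}
    (hzero : C 0 = ∅) (hlast : C n = Finset.univ) (hsub : ∀ j, j < n → C j ⊆ C (j + 1))
    (hC : ∀ j, j ≤ n → F (C j)) (hs0 : ∀ j, j < n → 0 ≤ s j)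
    (hmono : ∀ i j, i ≤ j → j < n → s i ≤ s j)
    (hslope : ∀ j, j < n → ∑ k ∈ C (j + 1), Q k =
      ∑ k ∈ C j, Q k + s j * (G (#(C (j + 1))) - G (#(C j))))
    (hchord : ∀ j, j < n → ∀ B, F B → C j ⊆ B → B ⊆ C (j + 1) →
      ∑ k ∈ C j, Q k + s j * (G (#B) - G (#(C j))) ≤ ∑ k ∈ B, Q k)
    {y : ι → ℝ} (hy : ∀ k, ∃ j, j < n ∧ y k = s j ∧ k ∈ C (j + 1) ∧ k ∉ C j) :
    IsSlope F G Q y := by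
  have hCmono : ∀ i j, i ≤ j → j ≤ n → C i ⊆ C j := by
    intro i j hij
    induction j, hij using Nat.le_induction with
    | base => exact fun _ => Subset.rfl
    | succ j hij ih => exact fun hj => (ih (by omega)).trans (hsub j (by omega))
  have step : ∀ c, ∀ j, j < n → excess G Q c (C (j + 1)) - excess G Q c (C j) =
      (s j - c) * (G (#(C (j + 1))) - G (#(C j))) := by
    intro c j hj
    unfold excess
    rw [hslope j hj]; ring
  have hgap : ∀ j, j < n → 0 ≤ G (#(C (j + 1))) - G (#(C j)) := fun j hj =>
    sub_nonneg.2 (hG.strictMono.monotone (card_le_card (hsub j hj)))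
  -- the excess decreases along the chain up to slope `c`, and increases from there on
  have hdec : ∀ c, ∀ i j, i ≤ j → j ≤ n → (∀ l, i ≤ l → l < j → s l ≤ c) →
      excess G Q c (C j) ≤ excess G Q c (C i) := by
    intro c i j hij
    induction j, hij using Nat.le_induction with
    | base => exact fun _ _ => le_rfl
    | succ j hij ih =>
      intro hj hl
      have h1 := ih (by omega) fun l h1 h2 => hl l h1 (by omega)
      have h2 := step c j (by omega)
      have h3 := mul_nonneg (sub_nonneg.2 (hl j hij (by omega))) (hgap j (by omega))
      linarith
  have hinc : ∀ c, ∀ i j, i ≤ j → j ≤ n → (∀ l, i ≤ l → l < j → c ≤ s l) →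
      excess G Q c (C i) ≤ excess G Q c (C j) := by
    intro c i j hij
    induction j, hij using Nat.le_induction with
    | base => exact fun _ _ => le_rfl
    | succ j hij ih =>
      intro hj hl
      have h1 := ih (by omega) fun l h1 h2 => hl l h1 (by omega)
      have h2 := step c j (by omega)
      have h3 := mul_nonneg (sub_nonneg.2 (hl j hij (by omega))) (hgap j (by omega))
      linarith
  -- Some member of the chain is at least as good as B. If B is incomparable with `C j`, the union
  -- lies between two neighbours of the chain, and `excess_union_le` yields a comparison either with
  -- `C 0` or with `C (j + 1)`.
  have key : ∀ c, 0 ≤ c → ∀ j, j ≤ n → ∀ B, F B → B ⊆ C j →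
      ∃ l, l ≤ j ∧ excess G Q c (C l) ≤ excess G Q c B := by
    intro c hc j
    induction j with
    | zero =>
      intro _ B _ hB
      rw [hzero, subset_empty] at hB
      exact ⟨0, le_rfl, by rw [hB, hzero]⟩
    | succ j ih =>
      intro hj B hB hBC
      have hj' : j < n := hj
      -- Along a chord the excess is affine in G, so an endpoint minimizes it; the sign of `s j - c`
      -- tells which.
      have hU : ∀ B, F B → C j ⊆ B → B ⊆ C (j + 1) →
          excess G Q c (C j) ≤ excess G Q c B ∨
          (s j ≤ c ∧ excess G Q c (C (j + 1)) ≤ excess G Q c B) := by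
        intro B hB h1 h2
        have h3 := hchord j hj' B hB h1 h2
        have h4 := hG.strictMono.monotone (card_le_card h1)
        have h5 := hG.strictMono.monotone (card_le_card h2)
        rcases le_total c (s j) with hcs | hcs
        · left
          have := mul_nonneg (sub_nonneg.2 hcs) (sub_nonneg.2 h4)
          unfold excess
          linarith
        · right
          refine ⟨hcs, ?_⟩
          have := mul_nonneg (sub_nonneg.2 hcs) (sub_nonneg.2 h5)
          unfold excess
          rw [hslope j hj']
          linarith
      by_cases hBj : B ⊆ C j
      · obtain ⟨l, hl, h⟩ := ih hj'.le B hB hBj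
        exact ⟨l, by omega, h⟩
      by_cases hjB : C j ⊆ B
      · rcases hU B hB hjB hBC with h | ⟨-, h⟩
        exacts [⟨j, by omega, h⟩, ⟨j + 1, le_rfl, h⟩]
      have h1 := excess_union_le hG hQ hc hBj hjB
      rcases hU (B ∪ C j) (hF.union _ _ hB (hC j hj'.le)) subset_union_right
        (union_subset hBC (hsub j hj')) with h | ⟨hcs, h⟩
      · exact ⟨0, by omega, by rw [hzero, excess_empty hG]; linarith⟩
      · refine ⟨j + 1, le_rfl, ?_⟩
        have := hdec c 0 j (Nat.zero_le _) hj'.le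
          fun l _ hl => (hmono l j hl.le hj').trans hcs
        rw [hzero, excess_empty hG] at this
        linarith
  have hlevel : ∀ c, 0 ≤ c → ∃ i, i ≤ n ∧ levelSet y c = C i ∧
      (∀ l, l < i → s l ≤ c) ∧ ∀ l, i ≤ l → l < n → c ≤ s l := by
    intro c hc
    classical
    -- By monotonicity the slopes at most c are exactly the first i ones, so the level set is `C i`.
    set i := #{l ∈ range n | s l ≤ c} with hi
    have hiff : ∀ l, l < n → (s l ≤ c ↔ l < i) := by
      intro l hl
      constructor
      · intro hlc
        have : range (l + 1) ⊆ {l ∈ range n | s l ≤ c} := by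
          intro m hm
          rw [mem_range] at hm
          rw [mem_filter, mem_range]
          exact ⟨by omega, (hmono m l (by omega) hl).trans hlc⟩
        have := card_le_card this
        rw [card_range] at this
        omega
      · intro hli
        by_contra! hlc
        have : {l ∈ range n | s l ≤ c} ⊆ range l := by
          intro m hm
          rw [mem_filter, mem_range] at hm
          rw [mem_range]
          by_contra! hlm
          exact absurd (hmono l m hlm hm.1) (not_le.2 (hm.2.trans_lt hlc))
        have := card_le_card this
        rw [card_range] at this
        omega
    have hin : i ≤ n := by
      have := card_filter_le (range n) fun l => s l ≤ c
      rwa [card_range] at this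
    refine ⟨i, hin, ?_, fun l hl => (hiff l (by omega)).2 hl,
      fun l hl hln => le_of_not_ge fun h => by have := (hiff l hln).1 h; omega⟩
    ext k
    obtain ⟨j, hj, hyk, hk1, hk2⟩ := hy k
    rw [mem_levelSet, hyk, hiff j hj]
    constructor
    · exact fun h => hCmono (j + 1) i h hin hk1
    · intro h
      by_contra! hij
      exact hk2 (hCmono i j hij hj.le h)
  refine ⟨fun k => ?_, fun c hc => ?_, fun c hc B hB => ?_⟩
  · obtain ⟨j, hj, hyk, -⟩ := hy k
    rw [hyk]; exact hs0 j hj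
  · obtain ⟨i, hi, he, -⟩ := hlevel c hc
    rw [he]; exact hC i hi
  · obtain ⟨i, hi, he, h1, h2⟩ := hlevel c hc
    obtain ⟨l, hl, h⟩ := key c hc n le_rfl B hB (hlast ▸ subset_univ B)
    rw [he]
    refine le_trans ?_ h
    rcases le_total l i with hli | hil
    · exact hdec c l i hli hi fun m _ hm => h1 m hm
    · exact hinc c i l hil hl fun m hm hm' => h2 m hm (by omega)

end Slopes

/-! ### The Lyapunov function -/

section Lyapunov

variable {ι : Type*} [Fintype ι] [DecidableEq ι]

open Classical in
/-- The largest value of `Q(Aᶜ) - c (G(|univ|) - G(|A|))` over the members `A` of `F`. -/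
noncomputable def gain (F : Finset ι → Prop) (G : ℕ → ℝ) (Q : ι → ℝ) (c : ℝ) : ℝ :=
  -- Inserting `univ`, whose value is 0, makes the supremum meaningful for arbitrary F.
  (insert Finset.univ (Finset.univ.filter F)).sup' (insert_nonempty _ _)
    fun A => excess G Q c Finset.univ - excess G Q c A

/-- A convex piecewise quadratic function whose gradient at `Q` is the slope of `Q`. -/
noncomputable def lyapunov (F : Finset ι → Prop) (G : ℕ → ℝ) (Q : ι → ℝ) : ℝ :=
  ∫ c in (0 : ℝ)..(∑ k, Q k) / G 1, gain F G Q c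

variable {F : Finset ι → Prop} {G : ℕ → ℝ} {Q Q' y : ι → ℝ}

theorem continuous_gain : Continuous (gain F G Q) := by
  unfold gain
  refine Continuous.finset_sup'_apply _ fun A _ => ?_
  unfold excess
  fun_prop

theorem gain_nonneg (c : ℝ) : 0 ≤ gain F G Q c := by
  unfold gain
  refine le_trans ?_ (le_sup' _ (mem_insert_self _ _))
  simp

theorem exists_gain_eq (hF : UnionFamily F) (c : ℝ) :
    ∃ B, F B ∧ gain F G Q c = excess G Q c Finset.univ - excess G Q c B := by
  classical
  obtain ⟨B, hB, h⟩ := exists_mem_eq_sup' (insert_nonempty _ _)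
    (fun A => excess G Q c Finset.univ - excess G Q c A)
    (s := insert Finset.univ (Finset.univ.filter F))
  refine ⟨B, ?_, ?_⟩
  · rcases mem_insert.1 hB with rfl | hB
    · exact hF.univ
    · exact (mem_filter.1 hB).2
  · rw [gain, ← h]

theorem le_gain {B : Finset ι} (hB : F B) (c : ℝ) :
    excess G Q c Finset.univ - excess G Q c B ≤ gain F G Q c := by
  unfold gain
  exact le_sup' (fun A => excess G Q c Finset.univ - excess G Q c A)
    (mem_insert_of_mem (by simpa using hB))

/-- Any set other than `univ` loses at least c G(1) ≥ ∑ Q. Thus the upper limit in `lyapunov` may be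
raised, and two backlog vectors can be compared on one interval. -/
theorem gain_eq_zero (hG : Doubling G) (hF : UnionFamily F) (hQ : ∀ k, 0 ≤ Q k) {c : ℝ}
    (hc : (∑ k, Q k) / G 1 ≤ c) : gain F G Q c = 0 := by
  refine le_antisymm ?_ (gain_nonneg c)
  obtain ⟨B, -, h⟩ := exists_gain_eq (G := G) (Q := Q) hF c
  rw [h]
  rcases eq_or_ne B Finset.univ with rfl | hB
  · simp
  have h1 := hG.gap (card_lt_card (ssubset_univ_iff.2 hB))
  have h2 : 0 ≤ ∑ k ∈ B, Q k := sum_nonneg fun k _ => hQ k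
  have h3 : 0 ≤ (∑ k, Q k) / G 1 := div_nonneg (sum_nonneg fun k _ => hQ k) hG.one_pos.le
  rw [div_le_iff₀ hG.one_pos] at hc
  have h4 := mul_le_mul_of_nonneg_left h1 (a := c) (by
    have := hG.one_pos
    have h5 : 0 ≤ ∑ k, Q k := sum_nonneg fun k _ => hQ k
    exact nonneg_of_mul_nonneg_left (h5.trans hc) this)
  unfold excess
  linarith

theorem gain_le (hG : Doubling G) (hF : UnionFamily F) (hQ : ∀ k, 0 ≤ Q k) {c : ℝ}
    (hc : 0 ≤ c) : gain F G Q c ≤ ∑ k, Q k := by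
  obtain ⟨B, -, h⟩ := exists_gain_eq (G := G) (Q := Q) hF c
  rw [h]
  have h1 := mul_le_mul_of_nonneg_left (hG.strictMono.monotone (card_le_univ B)) hc
  have h2 : 0 ≤ ∑ k ∈ B, Q k := sum_nonneg fun k _ => hQ k
  unfold excess
  rw [card_univ]
  linarith

theorem lyapunov_eq (hG : Doubling G) (hF : UnionFamily F) (hQ : ∀ k, 0 ≤ Q k) {M : ℝ}
    (hM : (∑ k, Q k) / G 1 ≤ M) : lyapunov F G Q = ∫ c in (0 : ℝ)..M, gain F G Q c := by
  rw [lyapunov, ← intervalIntegral.integral_add_adjacent_intervals (b := (∑ k, Q k) / G 1) (c := M)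
    (continuous_gain.intervalIntegrable _ _) (continuous_gain.intervalIntegrable _ _)]
  have : ∫ c in (∑ k, Q k) / G 1..M, gain F G Q c = ∫ c in (∑ k, Q k) / G 1..M, (0 : ℝ) := by
    refine intervalIntegral.integral_congr fun c hc => ?_
    rw [Set.uIcc_of_le hM] at hc
    exact gain_eq_zero hG hF hQ hc.1
  rw [this]
  simp

theorem lyapunov_nonneg (hG : Doubling G) (hQ : ∀ k, 0 ≤ Q k) :
    0 ≤ lyapunov F G Q :=
  intervalIntegral.integral_nonneg (div_nonneg (sum_nonneg fun k _ => hQ k) hG.one_pos.le)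
    fun c _ => gain_nonneg c

theorem lyapunov_le_sq (hG : Doubling G) (hF : UnionFamily F) (hQ : ∀ k, 0 ≤ Q k) :
    lyapunov F G Q ≤ (∑ k, Q k) ^ 2 / G 1 := by
  have h0 : 0 ≤ (∑ k, Q k) / G 1 := div_nonneg (sum_nonneg fun k _ => hQ k) hG.one_pos.le
  have := intervalIntegral.integral_mono_on h0 ((continuous_gain (F := F) (G := G) (Q := Q)).intervalIntegrable (μ := volume) _ _)
    (continuous_const.intervalIntegrable _ _)
    (fun c hc => gain_le hG hF hQ hc.1 : ∀ c ∈ Set.Icc 0 _, gain F G Q c ≤ ∑ k, Q k)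
  rw [intervalIntegral.integral_const] at this
  refine this.trans (le_of_eq ?_)
  rw [smul_eq_mul]; ring

/-- Used with a = y_k: integrating the derivative 1_{c < y_k} of the gain produces y_k as a partial
derivative of the Lyapunov function. -/
theorem intervalIntegral_indicator_Iio {a M : ℝ} (h0 : 0 ≤ a) (h1 : a ≤ M) :
    ∫ c in (0 : ℝ)..M, (Set.Iio a).indicator (1 : ℝ → ℝ) c = a := by
  rw [intervalIntegral.integral_of_le (h0.trans h1), integral_indicator_one measurableSet_Iio,
    measureReal_restrict_apply measurableSet_Iio]
  have : Set.Iio a ∩ Set.Ioc 0 M = Set.Ioo 0 a := by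
    ext c
    simp only [Set.mem_inter_iff, Set.mem_Iio, Set.mem_Ioc, Set.mem_Ioo]
    exact ⟨fun h => ⟨h.2.1, h.1⟩, fun h => ⟨h.2, h.1, h.2.le.trans h1⟩⟩
  rw [this, Real.volume_real_Ioo_of_le h0, sub_zero]

/-- The parameters at which `X` and `Y` nearly tie, if `X` is smaller than `Y`. -/
def nearTie (G : ℕ → ℝ) (Q : ι → ℝ) (δ : ℝ) (X Y : Finset ι) : Set ℝ :=
  {c | #X < #Y ∧ |excess G Q c Y - excess G Q c X| ≤ δ}

omit [Fintype ι] [DecidableEq ι] in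
theorem measurableSet_nearTie (δ : ℝ) (X Y : Finset ι) : MeasurableSet (nearTie G Q δ X Y) := by
  by_cases h : #X < #Y
  · have : IsClosed (nearTie G Q δ X Y) := by
      simp only [nearTie, h, true_and]
      exact isClosed_le (by unfold excess; fun_prop) continuous_const
    exact this.measurableSet
  · have : nearTie G Q δ X Y = ∅ := by
      ext c; simp [nearTie, h]
    rw [this]; exact MeasurableSet.empty

omit [Fintype ι] [DecidableEq ι] in
-- The difference of the excesses is affine in c with slope at least G(1) in absolute value; the
-- centre is the parameter of the exact tie.
theorem nearTie_subset (hG : Doubling G) {δ : ℝ} (hδ : 0 ≤ δ) (X Y : Finset ι) :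
    ∃ a, nearTie G Q δ X Y ⊆ Set.Icc (a - δ / G 1) (a + δ / G 1) := by
  by_cases h : #X < #Y
  · have h1 := hG.gap h
    have h2 := hG.one_pos
    have h3 : 0 < G #Y - G #X := h2.trans_le h1
    refine ⟨(∑ k ∈ Y, Q k - ∑ k ∈ X, Q k) / (G #Y - G #X), ?_⟩
    rintro c ⟨-, hc⟩
    have h4 : |c - (∑ k ∈ Y, Q k - ∑ k ∈ X, Q k) / (G #Y - G #X)| ≤ δ / G 1 := by
      have : c - (∑ k ∈ Y, Q k - ∑ k ∈ X, Q k) / (G #Y - G #X) =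
          -((excess G Q c Y - excess G Q c X) / (G #Y - G #X)) := by
        unfold excess
        field_simp
        ring
      rw [this, abs_neg, abs_div, abs_of_pos h3]
      gcongr
    rw [abs_le] at h4
    exact ⟨by linarith, by linarith⟩
  · refine ⟨0, ?_⟩
    rintro c ⟨hc, -⟩
    exact absurd hc h

omit [Fintype ι] [DecidableEq ι] in
theorem intervalIntegral_nearTie_le (hG : Doubling G) {δ M : ℝ} (hδ : 0 ≤ δ) (hM : 0 ≤ M)
    (X Y : Finset ι) :
    ∫ c in (0 : ℝ)..M, (nearTie G Q δ X Y).indicator (1 : ℝ → ℝ) c ≤ 2 * (δ / G 1) := by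
  rw [intervalIntegral.integral_of_le hM,
    integral_indicator_one (measurableSet_nearTie δ X Y),
    measureReal_restrict_apply (measurableSet_nearTie δ X Y)]
  obtain ⟨a, ha⟩ := nearTie_subset (Q := Q) hG hδ X Y
  have h0 : 0 ≤ δ / G 1 := div_nonneg hδ hG.one_pos.le
  refine (measureReal_mono (Set.inter_subset_left.trans ha) (by simp)).trans (le_of_eq ?_)
  rw [Real.volume_real_Icc_of_le (by linarith)]
  ring

/-- If the level set remains optimal for Q', the change is linear. Another set B can gain at most δ
on it, so it helps only if it was within δ of optimal for Q; by `exists_near_tie` such c lie in a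
near-tie set, to which the error δ is charged. -/
theorem gain_le_gain_add (hG : Doubling G) (hF : UnionFamily F) (hQ : ∀ k, 0 ≤ Q k)
    (h : IsSlope F G Q y) {δ : ℝ} (hδ : ∑ k, |Q' k - Q k| ≤ δ) {c : ℝ} (hc : 0 ≤ c) :
    gain F G Q' c ≤ gain F G Q c +
      ∑ k, (Q' k - Q k) * (Set.Iio (y k)).indicator (1 : ℝ → ℝ) c +
      ∑ p : Finset ι × Finset ι, δ * (nearTie G Q δ p.1 p.2).indicator (1 : ℝ → ℝ) c := by
  have hδ0 : 0 ≤ δ := (sum_nonneg fun k _ => abs_nonneg _).trans hδ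
  obtain ⟨B, hB, hg⟩ := exists_gain_eq (G := G) (Q := Q') hF c
  have h1 := le_gain (G := G) (Q := Q) (h.mem c hc) c
  set A := levelSet y c with hA
  have hex : ∀ X : Finset ι, excess G Q' c X = excess G Q c X + ∑ k ∈ X, (Q' k - Q k) := by
    intro X
    unfold excess
    rw [sum_sub_distrib]; ring
  have h2 : ∑ k, (Q' k - Q k) * (Set.Iio (y k)).indicator (1 : ℝ → ℝ) c =
      ∑ k, (Q' k - Q k) - ∑ k ∈ A, (Q' k - Q k) := by
    rw [hA, levelSet, sum_filter, ← sum_sub_distrib]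
    refine sum_congr rfl fun k _ => ?_
    by_cases hk : y k ≤ c
    · simp [hk]
    · rw [if_neg hk, Set.indicator_of_mem (by simpa using hk)]
      simp
  have h3 : ∀ p ∈ (Finset.univ : Finset (Finset ι × Finset ι)),
      0 ≤ δ * (nearTie G Q δ p.1 p.2).indicator (1 : ℝ → ℝ) c := fun p _ =>
    mul_nonneg hδ0 (Set.indicator_nonneg (fun _ _ => zero_le_one) _)
  rw [hg, hex, hex, h2]
  by_cases he : B = A
  · have := sum_nonneg h3
    rw [he]
    linarith
  have h4 : ∑ k ∈ A, (Q' k - Q k) - ∑ k ∈ B, (Q' k - Q k) ≤ δ := by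
    refine le_trans ?_ hδ
    have hm : ∀ X : Finset ι, ∑ k ∈ X, (Q' k - Q k) = ∑ k, if k ∈ X then Q' k - Q k else 0 := by
      simp
    rw [hm A, hm B, ← sum_sub_distrib]
    refine sum_le_sum fun k _ => ?_
    have h5 := neg_le_abs (Q' k - Q k)
    have h6 := le_abs_self (Q' k - Q k)
    have h7 := abs_nonneg (Q' k - Q k)
    split_ifs <;> linarith
  by_cases hn : excess G Q c B ≤ excess G Q c A + δ
  · obtain ⟨X, Y, hXY, ht⟩ := h.exists_near_tie hG hF hQ hc hB he hn
    have h5 := single_le_sum h3 (mem_univ (X, Y))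
    rw [Set.indicator_of_mem (show c ∈ nearTie G Q δ X Y from ⟨hXY, ht⟩)] at h5
    have h6 := h.min c hc B hB
    simp only [Pi.one_apply, mul_one] at h5
    linarith
  · have := sum_nonneg h3
    linarith

/-- Integrate `gain_le_gain_add` over c: each near-tie set has length at most 2δ/G(1) and costs δ,
so the remainder is quadratic in δ and independent of Q. -/
theorem lyapunov_le_add (hG : Doubling G) (hF : UnionFamily F) (hQ : ∀ k, 0 ≤ Q k)
    (hQ' : ∀ k, 0 ≤ Q' k) (h : IsSlope F G Q y) {δ : ℝ} (hδ : ∑ k, |Q' k - Q k| ≤ δ) :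
    lyapunov F G Q' ≤ lyapunov F G Q + ∑ k, y k * (Q' k - Q k) +
      Fintype.card (Finset ι × Finset ι) * (δ * (2 * (δ / G 1))) := by
  have hδ0 : 0 ≤ δ := (sum_nonneg fun k _ => abs_nonneg _).trans hδ
  set M := max ((∑ k, Q k) / G 1) ((∑ k, Q' k) / G 1)
  have hM0 : 0 ≤ M := le_max_of_le_left
    (div_nonneg (sum_nonneg fun k _ => hQ k) hG.one_pos.le)
  rw [lyapunov_eq hG hF hQ (le_max_left _ _ : _ ≤ M),
    lyapunov_eq hG hF hQ' (le_max_right _ _ : _ ≤ M)]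
  have hind : ∀ s : Set ℝ, MeasurableSet s → ∀ r : ℝ, IntervalIntegrable
      (fun c => r * s.indicator (1 : ℝ → ℝ) c) volume 0 M := by
    intro s hs r
    refine IntervalIntegrable.const_mul ?_ _
    rw [intervalIntegrable_iff_integrableOn_Ioc_of_le hM0]
    exact (integrable_const (1 : ℝ)).indicator hs
  have hs1 : IntervalIntegrable (fun c => ∑ k, (Q' k - Q k) *
      (Set.Iio (y k)).indicator (1 : ℝ → ℝ) c) volume 0 M := by
    simpa only [Finset.sum_fn] using IntervalIntegrable.sum Finset.univ
      fun k (_ : k ∈ Finset.univ) => hind (Set.Iio (y k)) measurableSet_Iio (Q' k - Q k)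
  have hs2 : IntervalIntegrable (fun c => ∑ p : Finset ι × Finset ι, δ *
      (nearTie G Q δ p.1 p.2).indicator (1 : ℝ → ℝ) c) volume 0 M := by
    simpa only [Finset.sum_fn] using IntervalIntegrable.sum Finset.univ
      fun (p : Finset ι × Finset ι) (_ : p ∈ Finset.univ) =>
        hind (nearTie G Q δ p.1 p.2) (measurableSet_nearTie δ p.1 p.2) δ
  have hg := (continuous_gain (F := F) (G := G) (Q := Q)).intervalIntegrable (μ := volume) 0 M
  have h1 := intervalIntegral.integral_mono_on hM0
    ((continuous_gain (F := F) (G := G) (Q := Q')).intervalIntegrable _ _)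
    ((hg.add hs1).add hs2) (fun c hc => gain_le_gain_add hG hF hQ h hδ hc.1)
  rw [intervalIntegral.integral_add (hg.add hs1) hs2, intervalIntegral.integral_add hg hs1,
    intervalIntegral.integral_finsetSum fun k _ => hind _ measurableSet_Iio _,
    intervalIntegral.integral_finsetSum fun p _ => hind _ (measurableSet_nearTie _ _ _) _] at h1
  refine h1.trans (add_le_add (add_le_add le_rfl (le_of_eq ?_)) ?_)
  · refine sum_congr rfl fun k _ => ?_
    rw [intervalIntegral.integral_const_mul, intervalIntegral_indicator_Iio (h.nonneg k)
      ((h.le_div hG hF hQ k).trans (le_max_left _ _)), mul_comm]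
  · refine (sum_le_card_nsmul _ _ (δ * (2 * (δ / G 1))) fun p _ => ?_).trans ?_
    · rw [intervalIntegral.integral_const_mul]
      exact mul_le_mul_of_nonneg_left (intervalIntegral_nearTie_le hG hδ0 hM0 p.1 p.2) hδ0
    · rw [nsmul_eq_mul, card_univ]

end Lyapunov

/-! ### Rank orderings as chains of sets -/

namespace RankOrdering

variable {N : ℕ} (R : RankOrdering N)

theorem cls_zero : R.cls 0 = ∅ := by simp [cls]

theorem cls_succ (i : ℕ) : R.cls (i + 1) = R.classes.getD i ∅ := by simp [cls]

theorem cls_eq_getElem {i : ℕ} (h : i < R.classes.length) : R.cls (i + 1) = R.classes[i] := by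
  rw [cls_succ, List.getD_eq_getElem _ _ h]

theorem cls_eq_empty {i : ℕ} (h : R.classes.length ≤ i) : R.cls (i + 1) = ∅ := by
  rw [cls_succ, List.getD_eq_default _ _ h]

theorem cls_nonempty {i : ℕ} (h : i < R.classes.length) : (R.cls (i + 1)).Nonempty := by
  rw [R.cls_eq_getElem h]
  exact R.nonempty _ (List.getElem_mem h)

theorem disjoint_cls {i j : ℕ} (h : i ≠ j) : Disjoint (R.cls i) (R.cls j) := by
  wlog hij : i < j generalizing i j
  · exact (this h.symm (by omega)).symm
  rcases i with _ | i
  · rw [cls_zero]; exact disjoint_empty_left _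
  rcases j with _ | j
  · omega
  by_cases hj : j < R.classes.length
  · have hi : i < R.classes.length := by omega
    rw [R.cls_eq_getElem hi, R.cls_eq_getElem hj]
    exact List.pairwise_iff_getElem.1 R.disjoint i j hi hj (by omega)
  · rw [R.cls_eq_empty (not_lt.1 hj)]; exact disjoint_empty_right _

theorem exists_mem_cls (k : Fin N) : ∃ i, i < R.classes.length ∧ k ∈ R.cls (i + 1) := by
  obtain ⟨C, hC, hk⟩ := R.cover k
  obtain ⟨i, hi, rfl⟩ := List.getElem_of_mem hC
  exact ⟨i, hi, by rwa [R.cls_eq_getElem hi]⟩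

theorem rank_zero : R.rank 0 = 0 := rfl

theorem mem_cls_rank (k : Fin N) : k ∈ R.cls (R.rank k.succ) := by
  obtain ⟨i, -, hi⟩ := R.exists_mem_cls k
  exact Nat.sInf_mem (s := {i | k ∈ R.cls i}) ⟨_, hi⟩

theorem mem_cls {k : Fin N} {i : ℕ} : k ∈ R.cls i ↔ R.rank k.succ = i := by
  refine ⟨fun h => ?_, fun h => h ▸ R.mem_cls_rank k⟩
  by_contra hne
  exact disjoint_left.1 (R.disjoint_cls hne) (R.mem_cls_rank k) h

theorem rank_succ (k : Fin N) : ∃ i, i < R.classes.length ∧ R.rank k.succ = i + 1 := by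
  obtain ⟨i, hi, h⟩ := R.exists_mem_cls k
  exact ⟨i, hi, R.mem_cls.1 h⟩

theorem mem_cum {k : Fin N} {i : ℕ} : k ∈ R.cum i ↔ R.rank k.succ ≤ i := by
  simp only [cum, mem_biUnion, mem_Icc, R.mem_cls]
  obtain ⟨j, -, hj⟩ := R.rank_succ k
  exact ⟨fun ⟨a, ha, h⟩ => h ▸ ha.2, fun h => ⟨_, ⟨by omega, h⟩, rfl⟩⟩

theorem cum_zero : R.cum 0 = ∅ := by simp [cum]

theorem cum_succ (i : ℕ) : R.cum (i + 1) = R.cum i ∪ R.cls (i + 1) := by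
  ext k
  rw [mem_union, R.mem_cum, R.mem_cum, R.mem_cls]
  omega

theorem disjoint_cum_cls (i : ℕ) : Disjoint (R.cum i) (R.cls (i + 1)) := by
  rw [disjoint_left]
  intro k h1 h2
  rw [R.mem_cum] at h1
  rw [R.mem_cls] at h2
  omega

theorem cum_eq_univ {i : ℕ} (h : R.classes.length ≤ i) : R.cum i = univ := by
  ext k
  obtain ⟨j, hj, hk⟩ := R.rank_succ k
  rw [R.mem_cum, hk]
  exact ⟨fun _ => mem_univ _, fun _ => by omega⟩

theorem card_cum_succ (i : ℕ) : #(R.cum (i + 1)) = #(R.cum i) + #(R.cls (i + 1)) := by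
  rw [cum_succ, card_union_of_disjoint (R.disjoint_cum_cls i)]

theorem sum_cum_succ (Q : Fin N → ℝ) (i : ℕ) :
    ∑ k ∈ R.cum (i + 1), Q k = ∑ k ∈ R.cum i, Q k + ∑ k ∈ R.cls (i + 1), Q k := by
  rw [cum_succ, sum_union (R.disjoint_cum_cls i)]

theorem mem_cum_iff_take {k : Fin N} {i : ℕ} :
    k ∈ R.cum i ↔ ∃ C ∈ R.classes.take i, k ∈ C := by
  constructor
  · intro h
    rw [R.mem_cum] at h
    obtain ⟨j, hj, hk⟩ := R.rank_succ k
    refine ⟨R.classes[j], List.mem_take_iff_getElem.2 ⟨j, by omega, rfl⟩, ?_⟩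
    rw [← R.cls_eq_getElem hj, R.mem_cls, hk]
  · rintro ⟨C, hC, hk⟩
    obtain ⟨j, hj, rfl⟩ := List.mem_take_iff_getElem.1 hC
    rw [← R.cls_eq_getElem (by omega), R.mem_cls] at hk
    rw [R.mem_cum]
    omega

theorem penalty_succ (f : ℕ → ℕ → ℝ) (Q : Fin N → ℝ) (n : ℕ) :
    penalty f Q R (n + 1) = penalty f Q R n +
      f (#(R.cum n)) (#(R.cls (n + 1))) * ∑ k ∈ R.cls (n + 1), Q k := by
  unfold penalty
  rw [sum_Icc_succ_top (by omega)]
  simp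

variable {R}

theorem cls_of_classes_eq {l₁ l₂ : List (Finset (Fin N))} {C : Finset (Fin N)}
    (h : R.classes = l₁ ++ C :: l₂) : R.cls (l₁.length + 1) = C := by
  rw [cls_succ, h]
  simp

theorem cls_eq_of_append {R' : RankOrdering N} {l₁ l₂ l₂' : List (Finset (Fin N))}
    (h : R.classes = l₁ ++ l₂) (h' : R'.classes = l₁ ++ l₂') {i : ℕ} (hi : i ≤ l₁.length) :
    R.cls i = R'.cls i := by
  rcases i with _ | i
  · rw [cls_zero, cls_zero]
  · rw [cls_succ, cls_succ, h, h', List.getD_append _ _ _ _ hi, List.getD_append _ _ _ _ hi]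

theorem cum_eq_of_append {R' : RankOrdering N} {l₁ l₂ l₂' : List (Finset (Fin N))}
    (h : R.classes = l₁ ++ l₂) (h' : R'.classes = l₁ ++ l₂') {i : ℕ} (hi : i ≤ l₁.length) :
    R.cum i = R'.cum i := by
  unfold cum
  refine biUnion_congr rfl fun j hj => cls_eq_of_append h h' ?_
  rw [mem_Icc] at hj
  omega

theorem penalty_eq_of_append {R' : RankOrdering N} {l₁ l₂ l₂' : List (Finset (Fin N))}
    (h : R.classes = l₁ ++ l₂) (h' : R'.classes = l₁ ++ l₂') (f : ℕ → ℕ → ℝ) (Q : Fin N → ℝ) :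
    penalty f Q R l₁.length = penalty f Q R' l₁.length := by
  unfold penalty
  refine sum_congr rfl fun j hj => ?_
  rw [mem_Icc] at hj
  rw [cls_eq_of_append h h' hj.2, cum_eq_of_append h h' (by omega : j - 1 ≤ l₁.length)]

theorem mismatch_comm (R R' : RankOrdering N) : R.mismatch R' = R'.mismatch R := by
  simp only [mismatch, ne_comm]

theorem IsOneStepRefinement.length {R' : RankOrdering N} (h : R'.IsOneStepRefinement R) :
    R'.classes.length = R.classes.length + 1 := by
  obtain ⟨l₁, l₂, A, B, h, h'⟩ := h
  rw [h, h']
  simp only [List.length_append, List.length_cons]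
  omega

/-! ### Comparing a rank ordering with a one-step refinement -/

section Split

variable {R' : RankOrdering N} {l₁ l₂ : List (Finset (Fin N))} {A B : Finset (Fin N)}
  (h : R.classes = l₁ ++ (A ∪ B) :: l₂) (h' : R'.classes = l₁ ++ A :: B :: l₂)
include h'

theorem disjoint_of_split : Disjoint A B := by
  have := R'.disjoint
  rw [h', List.pairwise_append] at this
  have := this.2.1
  rw [List.pairwise_cons] at this
  exact this.1 B (by simp)

include h

theorem mismatch_of_split : R.mismatch R' = l₁.length + 1 := by
  have hB : B.Nonempty := R'.nonempty B (by simp [h'])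
  have hne : R.cls (l₁.length + 1) ≠ R'.cls (l₁.length + 1) := by
    rw [cls_of_classes_eq h, cls_of_classes_eq h']
    intro e
    obtain ⟨k, hk⟩ := hB
    exact disjoint_left.1 (disjoint_of_split h') (e ▸ mem_union_right A hk) hk
  refine le_antisymm (Nat.sInf_le hne) ?_
  refine le_csInf ⟨_, hne⟩ fun i hi => ?_
  by_contra! hlt
  exact hi (cls_eq_of_append h h' (by omega))

/-- The classes before the split cancel. Ties favour the finer ordering, so the coarser one must win
strictly here, while `≤` is enough in `penalizesLess_confinement_iff`. -/
theorem penalizesLess_refinement_iff (f : ℕ → ℕ → ℝ) (Q : Fin N → ℝ) : PenalizesLess f Q R R' ↔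
    f (#(R.cum l₁.length)) (#(A ∪ B)) * ∑ k ∈ A ∪ B, Q k <
      f (#(R.cum l₁.length)) (#A) * ∑ k ∈ A, Q k := by
  have hno : ¬ R.IsOneStepRefinement R' := fun hr => by
    have h1 := hr.length
    have h2 : R'.IsOneStepRefinement R := ⟨l₁, l₂, A, B, h, h'⟩
    have := h2.length
    omega
  rw [PenalizesLess, mismatch_of_split h h', penalty_succ, penalty_succ, cls_of_classes_eq h,
    cls_of_classes_eq h', penalty_eq_of_append h h' f Q, cum_eq_of_append h h' le_rfl]
  simp [hno]

theorem penalizesLess_confinement_iff (f : ℕ → ℕ → ℝ) (Q : Fin N → ℝ) : PenalizesLess f Q R' R ↔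
    f (#(R.cum l₁.length)) (#A) * ∑ k ∈ A, Q k ≤
      f (#(R.cum l₁.length)) (#(A ∪ B)) * ∑ k ∈ A ∪ B, Q k := by
  have hyes : R'.IsOneStepRefinement R := ⟨l₁, l₂, A, B, h, h'⟩
  rw [PenalizesLess, mismatch_comm, mismatch_of_split h h', penalty_succ, penalty_succ,
    cls_of_classes_eq h, cls_of_classes_eq h', penalty_eq_of_append h h' f Q,
    cum_eq_of_append h h' le_rfl]
  simp [hyes, le_iff_lt_or_eq]

/-- A refinement adds a single set to the chain, so only that set has to be checked for membership
in F; a confinement adds none. -/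
theorem cum_refinement (i : ℕ) : R'.cum i = R.cum i ∨ R'.cum i = R.cum l₁.length ∪ A ∨
    ∃ j, R'.cum i = R.cum j := by
  rcases Nat.lt_trichotomy i (l₁.length + 1) with hi | rfl | hi
  · exact Or.inl (cum_eq_of_append h h' (by omega)).symm
  · right; left
    rw [cum_succ, cls_of_classes_eq h', cum_eq_of_append h h' le_rfl]
  · right; right
    obtain ⟨j, rfl⟩ := Nat.exists_eq_add_of_le hi
    refine ⟨l₁.length + 1 + j, ?_⟩
    ext k
    rw [mem_cum_iff_take, mem_cum_iff_take, h, h', List.take_append, List.take_append]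
    have e1 : l₁.length + 1 + 1 + j - l₁.length = j + 2 := by omega
    have e2 : l₁.length + 1 + j - l₁.length = j + 1 := by omega
    rw [e1, e2, List.take_of_length_le (l := l₁) (by omega), List.take_of_length_le (l := l₁) (by omega)]
    simp [or_and_right, exists_or, or_assoc]

theorem cum_confinement (i : ℕ) : ∃ j, R.cum i = R'.cum j := by
  rcases Nat.lt_or_ge i (l₁.length + 1) with hi | hi
  · exact ⟨i, cum_eq_of_append h h' (by omega)⟩
  · obtain ⟨j, rfl⟩ := Nat.exists_eq_add_of_le hi
    refine ⟨l₁.length + 1 + 1 + j, ?_⟩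
    ext k
    rw [mem_cum_iff_take, mem_cum_iff_take, h, h', List.take_append, List.take_append]
    have e1 : l₁.length + 1 + 1 + j - l₁.length = j + 2 := by omega
    have e2 : l₁.length + 1 + j - l₁.length = j + 1 := by omega
    rw [e1, e2, List.take_of_length_le (l := l₁) (by omega), List.take_of_length_le (l := l₁) (by omega)]
    simp [or_and_right, exists_or, or_assoc]

end Split

/-- Splitting a class of a rank ordering. -/
theorem exists_refinement {i : ℕ} (hi : i < R.classes.length) {A : Finset (Fin N)}
    (hA : A.Nonempty) (hsub : A ⊂ R.cls (i + 1)) :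
    ∃ (R' : RankOrdering N) (l₁ l₂ : List (Finset (Fin N))), l₁.length = i ∧
      R.classes = l₁ ++ (A ∪ (R.cls (i + 1) \ A)) :: l₂ ∧
      R'.classes = l₁ ++ A :: (R.cls (i + 1) \ A) :: l₂ := by
  have hun : A ∪ (R.cls (i + 1) \ A) = R.cls (i + 1) := union_sdiff_of_subset hsub.1
  have hcl : R.classes = R.classes.take i ++ R.cls (i + 1) :: R.classes.drop (i + 1) := by
    rw [R.cls_eq_getElem hi, ← List.drop_eq_getElem_cons hi, List.take_append_drop]
  have hd := R.disjoint
  have hn := R.nonempty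
  have hc := R.cover
  rw [hcl] at hd hn hc
  generalize R.cls (i + 1) = C at *
  have hCA : (C \ A) ⊆ C := sdiff_subset
  refine ⟨⟨R.classes.take i ++ A :: (C \ A) :: R.classes.drop (i + 1), ?_, ?_, ?_⟩,
    R.classes.take i, R.classes.drop (i + 1), by simp; omega, by rwa [hun], rfl⟩
  · intro D hD
    simp only [List.mem_append, List.mem_cons] at hD hn
    rcases hD with h | rfl | rfl | h
    · exact hn D (Or.inl h)
    · exact hA
    · exact sdiff_nonempty.2 hsub.2
    · exact hn D (Or.inr (Or.inr h))
  · rw [List.pairwise_append, List.pairwise_cons] at hd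
    rw [List.pairwise_append, List.pairwise_cons, List.pairwise_cons]
    obtain ⟨h1, ⟨h2, h3⟩, h4⟩ := hd
    refine ⟨h1, ⟨?_, ?_, h3⟩, ?_⟩
    · intro D hD
      rcases List.mem_cons.1 hD with rfl | hD
      · exact disjoint_sdiff
      · exact (h2 D hD).mono_left hsub.1
    · exact fun D hD => (h2 D hD).mono_left hCA
    · intro D hD E hE
      rcases List.mem_cons.1 hE with rfl | hE
      · exact (h4 D hD C (by simp)).mono_right hsub.1
      rcases List.mem_cons.1 hE with rfl | hE
      · exact (h4 D hD C (by simp)).mono_right hCA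
      · exact h4 D hD E (List.mem_cons_of_mem _ hE)
  · intro k
    obtain ⟨D, hD, hk⟩ := hc k
    simp only [List.mem_append, List.mem_cons] at hD ⊢
    rcases hD with h | rfl | h
    · exact ⟨D, Or.inl h, hk⟩
    · by_cases hkA : k ∈ A
      · exact ⟨A, by simp, hkA⟩
      · exact ⟨D \ A, by simp, mem_sdiff.2 ⟨hk, hkA⟩⟩
    · exact ⟨D, Or.inr (Or.inr (Or.inr h)), hk⟩

/-- Merging two neighbouring classes of a rank ordering. -/
theorem exists_confinement {i : ℕ} (hi : i + 1 < R.classes.length) :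
    ∃ (R' : RankOrdering N) (l₁ l₂ : List (Finset (Fin N))), l₁.length = i ∧
      R'.classes = l₁ ++ (R.cls (i + 1) ∪ R.cls (i + 1 + 1)) :: l₂ ∧
      R.classes = l₁ ++ R.cls (i + 1) :: R.cls (i + 1 + 1) :: l₂ := by
  have hcl : R.classes = R.classes.take i ++ R.cls (i + 1) :: R.cls (i + 1 + 1) ::
      R.classes.drop (i + 2) := by
    rw [R.cls_eq_getElem hi, R.cls_eq_getElem (by omega : i < R.classes.length),
      ← List.drop_eq_getElem_cons hi, ← List.drop_eq_getElem_cons, List.take_append_drop]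
  have hd := R.disjoint
  have hn := R.nonempty
  have hc := R.cover
  rw [hcl] at hd hn hc
  generalize R.cls (i + 1) = C at *
  generalize R.cls (i + 1 + 1) = D at *
  refine ⟨⟨R.classes.take i ++ (C ∪ D) :: R.classes.drop (i + 2), ?_, ?_, ?_⟩,
    R.classes.take i, R.classes.drop (i + 2), by simp; omega, rfl, hcl⟩
  · intro E hE
    simp only [List.mem_append, List.mem_cons] at hE hn
    rcases hE with h | rfl | h
    · exact hn E (Or.inl h)
    · exact (hn C (by simp)).mono subset_union_left
    · exact hn E (by simp [h])
  · rw [List.pairwise_append, List.pairwise_cons, List.pairwise_cons] at hd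
    rw [List.pairwise_append, List.pairwise_cons]
    obtain ⟨h1, ⟨h2, h3, h4⟩, h5⟩ := hd
    refine ⟨h1, ⟨fun E hE => disjoint_union_left.2 ⟨h2 E (by simp [hE]), h3 E hE⟩, h4⟩, ?_⟩
    intro E hE E' hE'
    rcases List.mem_cons.1 hE' with rfl | hE'
    · exact disjoint_union_right.2 ⟨h5 E hE C (by simp), h5 E hE D (by simp)⟩
    · exact h5 E hE E' (by simp [hE'])
  · intro k
    obtain ⟨E, hE, hk⟩ := hc k
    simp only [List.mem_append, List.mem_cons] at hE ⊢
    rcases hE with h | rfl | rfl | h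
    · exact ⟨E, Or.inl h, hk⟩
    · exact ⟨_, Or.inr (Or.inl rfl), mem_union_left _ hk⟩
    · exact ⟨_, Or.inr (Or.inl rfl), mem_union_right _ hk⟩
    · exact ⟨E, Or.inr (Or.inr h), hk⟩

end RankOrdering

/-! ### The weights -/

/-- `1 / f 0 n`, by (C1). -/
noncomputable def cumWeight (f : ℕ → ℕ → ℝ) (n : ℕ) : ℝ := ∑ l ∈ range n, 1 / f l 1

section Weight

variable {f : ℕ → ℕ → ℝ}
  (hC1 : ∀ m n₁ n₂, 0 < n₁ → 0 < n₂ → 1 / f m (n₁ + n₂) = 1 / f m n₁ + 1 / f (m + n₁) n₂)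
include hC1

/-- (C1) makes 1/f(m,n) additive over adjacent integer intervals, so it is the sum of the unit terms
1/f(l,1) for m ≤ l < m + n. -/
theorem one_div_eq_cumWeight_sub (m : ℕ) {n : ℕ} (hn : 0 < n) :
    1 / f m n = cumWeight f (m + n) - cumWeight f m := by
  induction n, hn using Nat.le_induction with
  | base => simp [cumWeight, sum_range_succ]
  | succ n hn ih =>
    rw [hC1 m n 1 hn one_pos, ih, cumWeight, cumWeight, cumWeight, ← add_assoc,
      sum_range_succ _ (m + n)]
    ring

theorem eq_one_div_cumWeight_sub (m n : ℕ) (hn : 0 < n) :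
    f m n = 1 / (cumWeight f (m + n) - cumWeight f m) := by
  rw [← one_div_eq_cumWeight_sub hC1 m hn, one_div_one_div]

theorem doubling_cumWeight (hpos : ∀ m n, 0 < n → 0 < f m n)
    (hC2 : ∀ m n₁ n₂, 0 < n₁ → 0 < n₂ → f (m + n₁) n₂ ≤ f m n₁) : Doubling (cumWeight f) where
  zero := by simp [cumWeight]
  strictMono := strictMono_nat_of_lt_succ fun n => by
    rw [cumWeight, cumWeight, sum_range_succ]
    have := one_div_pos.2 (hpos n 1 one_pos)
    linarith
  two_mul_le a b hab := by
    obtain ⟨k, rfl⟩ := Nat.exists_eq_add_of_lt hab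
    have h0 : cumWeight f 0 = 0 := by simp [cumWeight]
    rcases Nat.eq_zero_or_pos a with rfl | ha
    · rw [h0, mul_zero]
      exact sum_nonneg fun l _ => (one_div_pos.2 (hpos l 1 one_pos)).le
    -- (C2) with m = 0 and n₁ = a reads G(a) ≤ G(a + k + 1) - G(a).
    · have h1 := one_div_le_one_div_of_le (hpos (0 + a) (k + 1) k.succ_pos)
        (hC2 0 a (k + 1) ha k.succ_pos)
      rw [one_div_eq_cumWeight_sub hC1 _ ha, one_div_eq_cumWeight_sub hC1 _ k.succ_pos,
        h0, zero_add, Nat.succ_eq_add_one, ← add_assoc] at h1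
      linarith

end Weight

namespace RankOrdering

variable {N : ℕ}

/-! ### Cones and slopes -/

/-- The cone of `R` if only the rank orderings with initial unions in `F` compete with `R`. -/
def familyCone (F : Finset (Fin N) → Prop) (f : ℕ → ℕ → ℝ) (R : RankOrdering N) :
    Set (Fin N → ℝ) :=
  {Q | (∀ k, 0 ≤ Q k) ∧
    ∀ R' : RankOrdering N, (∀ i, F (R'.cum i)) → R.Adjacent R' → PenalizesLess f Q R R'}

/-- `f(|C^{i-1}|, |C_i|) Q_{C_i}` for the class `C_i` of `k`. -/
noncomputable def slope (f : ℕ → ℕ → ℝ) (Q : Fin N → ℝ) (R : RankOrdering N) (k : Fin N) : ℝ :=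
  f (#(R.cum (R.rank k.succ - 1))) (#(R.cls (R.rank k.succ))) * ∑ j ∈ R.cls (R.rank k.succ), Q j

section Cone

variable {F : Finset (Fin N) → Prop} {f : ℕ → ℕ → ℝ} {G : ℕ → ℝ} {Q : Fin N → ℝ}
  {R : RankOrdering N}

/-- Merging two neighbouring classes must not be penalized less, so the first chord is no steeper
than the chord of the union, which amounts to being no steeper than the second. -/
theorem classSlope_le (hR : ∀ i, F (R.cum i)) (hQ : Q ∈ familyCone F f R)
    (hG : Doubling G) (hf : ∀ m n, 0 < n → f m n = 1 / (G (m + n) - G m))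
    {i j : ℕ} (hij : i ≤ j) (hj : j < R.classes.length) :
    f (#(R.cum i)) (#(R.cls (i + 1))) * ∑ k ∈ R.cls (i + 1), Q k ≤
      f (#(R.cum j)) (#(R.cls (j + 1))) * ∑ k ∈ R.cls (j + 1), Q k := by
  induction j, hij using Nat.le_induction with
  | base => exact le_rfl
  | succ j hij ih =>
    refine (ih (by omega)).trans ?_
    obtain ⟨R', l₁, l₂, hl, h, h'⟩ := exists_confinement hj
    have hR' : ∀ i, F (R'.cum i) := fun i => by
      obtain ⟨j, hj⟩ := cum_confinement h h' i
      rw [hj]; exact hR j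
    have h1 := (penalizesLess_confinement_iff h h' f Q).1
      (hQ.2 R' hR' (Or.inr ⟨l₁, l₂, _, _, h, h'⟩))
    have hcum : R'.cum l₁.length = R.cum j := by
      rw [← hl]; exact cum_eq_of_append h h' le_rfl
    have hcard := R.card_cum_succ j
    have hp1 : 0 < #(R.cls (j + 1)) := card_pos.2 (R.cls_nonempty (by omega))
    have hp2 : 0 < #(R.cls (j + 1 + 1)) := card_pos.2 (R.cls_nonempty hj)
    rw [hcum, card_union_of_disjoint (R.disjoint_cls (by omega)),
      sum_union (R.disjoint_cls (by omega)), hf _ _ hp1, hf _ _ (by omega)] at h1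
    rw [hf _ _ hp1, hf _ _ hp2, hcard]
    have hg1 := hG.one_pos.trans_le
      (hG.gap (show #(R.cum j) < #(R.cum j) + #(R.cls (j + 1)) by omega))
    have hg2 := hG.one_pos.trans_le (hG.gap (show #(R.cum j) + #(R.cls (j + 1)) <
      #(R.cum j) + #(R.cls (j + 1)) + #(R.cls (j + 1 + 1)) by omega))
    rw [← add_assoc] at h1
    rw [one_div_mul_eq_div, one_div_mul_eq_div, div_le_div_iff₀ hg1 (by linarith)] at h1
    rw [one_div_mul_eq_div, one_div_mul_eq_div, div_le_div_iff₀ hg1 hg2]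
    linarith

/-- Confinements supply the monotone slopes and refinements the chord condition of
`isSlope_of_chain`. -/
theorem isSlope_slope (hG : Doubling G) (hF : UnionFamily F)
    (hf : ∀ m n, 0 < n → f m n = 1 / (G (m + n) - G m)) (hR : ∀ i, F (R.cum i))
    (hQ : Q ∈ familyCone F f R) : IsSlope F G Q (R.slope f Q) := by
  have hgap : ∀ a b, 0 < b → 0 < G (a + b) - G a := fun a b hb =>
    hG.one_pos.trans_le (hG.gap (by omega))
  have hslope : ∀ j, j < R.classes.length → ∑ k ∈ R.cum (j + 1), Q k = ∑ k ∈ R.cum j, Q k +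
      f (#(R.cum j)) (#(R.cls (j + 1))) * (∑ k ∈ R.cls (j + 1), Q k) *
        (G (#(R.cum (j + 1))) - G (#(R.cum j))) := by
    intro j hj
    have hp : 0 < #(R.cls (j + 1)) := card_pos.2 (R.cls_nonempty hj)
    have := hgap #(R.cum j) _ hp
    rw [R.sum_cum_succ, R.card_cum_succ, hf _ _ hp]
    field_simp
  refine isSlope_of_chain hG hF hQ.1 (n := R.classes.length) (C := R.cum)
    (s := fun j => f (#(R.cum j)) (#(R.cls (j + 1))) * ∑ k ∈ R.cls (j + 1), Q k)
    R.cum_zero (R.cum_eq_univ le_rfl) (fun j _ => ?_) (fun j _ => hR j) (fun j hj => ?_)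
    (fun i j hij hj => classSlope_le hR hQ hG hf hij hj) hslope ?_ ?_
  · rw [cum_succ]; exact subset_union_left
  · have hp : 0 < #(R.cls (j + 1)) := card_pos.2 (R.cls_nonempty hj)
    have := hgap #(R.cum j) _ hp
    rw [hf _ _ hp]
    have := sum_nonneg fun k (_ : k ∈ R.cls (j + 1)) => hQ.1 k
    positivity
  · intro j hj B hB h1 h2
    have hBA : B = R.cum j ∪ (B \ R.cum j) := (union_sdiff_of_subset h1).symm
    have hsub : B \ R.cum j ⊆ R.cls (j + 1) := by
      intro k hk
      rw [Finset.mem_sdiff] at hk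
      have := h2 hk.1
      rw [cum_succ, mem_union] at this
      exact this.resolve_left hk.2
    -- At either endpoint the chord inequality is an equality; otherwise B splits a class properly,
    -- and B is the only new set in the refined chain.
    rcases hsub.eq_or_ssubset with he | hss
    · rw [he, ← cum_succ] at hBA
      rw [hBA]
      exact (hslope j hj).ge
    rcases (B \ R.cum j).eq_empty_or_nonempty with he | hne
    · rw [he, union_empty] at hBA
      rw [hBA]
      simp
    obtain ⟨R', l₁, l₂, hl, h, h'⟩ := exists_refinement hj hne hss
    have hR' : ∀ i, F (R'.cum i) := by
      intro i
      rcases cum_refinement h h' i with h3 | h3 | ⟨m, h3⟩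
      · rw [h3]; exact hR i
      · rw [h3, hl, ← hBA]; exact hB
      · rw [h3]; exact hR m
    have h4 := (penalizesLess_refinement_iff h h' f Q).1
      (hQ.2 R' hR' (Or.inl ⟨l₁, l₂, _, _, h, h'⟩))
    rw [hl, union_sdiff_of_subset hsub] at h4
    have hp := card_pos.2 hne
    have hpg := hgap #(R.cum j) _ hp
    rw [hf _ (#(B \ R.cum j)) hp, one_div_mul_eq_div, lt_div_iff₀ hpg] at h4
    have hcard : #B = #(R.cum j) + #(B \ R.cum j) := by
      rw [add_comm, card_sdiff_add_card_eq_card h1]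
    have hsum := sum_sdiff h1 (f := Q)
    rw [hcard]
    linarith
  · intro k
    obtain ⟨j, hj, hk⟩ := R.rank_succ k
    refine ⟨j, hj, ?_, ?_, ?_⟩
    · simp only [slope, hk, Nat.add_sub_cancel]
    · rw [mem_cum]; omega
    · rw [mem_cum]; omega

theorem slope_le_slope (hG : Doubling G)
    (hf : ∀ m n, 0 < n → f m n = 1 / (G (m + n) - G m)) (hR : ∀ i, F (R.cum i))
    (hQ : Q ∈ familyCone F f R) {j k : Fin N} (h : R.rank j.succ ≤ R.rank k.succ) :
    R.slope f Q j ≤ R.slope f Q k := by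
  obtain ⟨a, ha, hja⟩ := R.rank_succ j
  obtain ⟨b, hb, hkb⟩ := R.rank_succ k
  simp only [slope, hja, hkb, Nat.add_sub_cancel]
  exact classSlope_le hR hQ hG hf (by omega) hb

end Cone

/-! ### Every backlog vector lies in a cone -/

/-- Twice the area below the polygon through the points `(G |C^i|, Q(C^i))`. -/
noncomputable def area (G : ℕ → ℝ) (Q : Fin N → ℝ) : ℕ → ℝ → List (Finset (Fin N)) → ℝ
  | _, _, [] => 0
  | m, h, C :: l => (G (m + #C) - G m) * (2 * h + ∑ k ∈ C, Q k) +
      area G Q (m + #C) (h + ∑ k ∈ C, Q k) l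

theorem area_append (G : ℕ → ℝ) (Q : Fin N → ℝ) (l₁ : List (Finset (Fin N))) (m : ℕ) (h : ℝ) :
    ∃ a b, ∀ l₂, area G Q m h (l₁ ++ l₂) = a + area G Q (m + (l₁.map card).sum) b l₂ := by
  induction l₁ generalizing m h with
  | nil => exact ⟨0, h, fun l₂ => by simp⟩
  | cons C l ih =>
    obtain ⟨a, b, hab⟩ := ih (m + #C) (h + ∑ k ∈ C, Q k)
    refine ⟨(G (m + #C) - G m) * (2 * h + ∑ k ∈ C, Q k) + a, b, fun l₂ => ?_⟩
    rw [List.cons_append, area, hab, List.map_cons, List.sum_cons, ← add_assoc, ← add_assoc]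

theorem card_cum_eq_sum (R : RankOrdering N) (i : ℕ) :
    #(R.cum i) = ((R.classes.take i).map card).sum := by
  induction i with
  | zero => simp [cum_zero]
  | succ i ih =>
    rw [card_cum_succ, ih]
    by_cases hi : i < R.classes.length
    · rw [List.take_succ_eq_append_getElem hi, R.cls_eq_getElem hi]
      simp only [List.map_append, List.sum_append, List.map_cons, List.map_nil, List.sum_cons,
        List.sum_nil, add_zero]
    · rw [R.cls_eq_empty (not_lt.1 hi), List.take_of_length_le (not_lt.1 hi),
        List.take_of_length_le (by omega)]
      simp

/-- All other trapezoids cancel, leaving twice the signed area of the triangle spanned by the chord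
and the new vertex. -/
theorem area_refinement (G : ℕ → ℝ) (Q : Fin N → ℝ) {R R' : RankOrdering N}
    {l₁ l₂ : List (Finset (Fin N))} {A B : Finset (Fin N)}
    (h : R.classes = l₁ ++ (A ∪ B) :: l₂) (h' : R'.classes = l₁ ++ A :: B :: l₂) :
    area G Q 0 0 R'.classes - area G Q 0 0 R.classes =
      (G (#(R.cum l₁.length) + #(A ∪ B)) - G #(R.cum l₁.length)) * ∑ k ∈ A, Q k -
      (G (#(R.cum l₁.length) + #A) - G #(R.cum l₁.length)) * ∑ k ∈ A ∪ B, Q k := by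
  have hc : #(R.cum l₁.length) = 0 + (l₁.map card).sum := by
    rw [card_cum_eq_sum, h]; simp
  obtain ⟨a, b, hab⟩ := area_append G Q l₁ 0 0
  rw [h, h', hab, hab, ← hc, area, area, area, card_union_of_disjoint (disjoint_of_split h'),
    sum_union (disjoint_of_split h'), ← add_assoc, ← add_assoc]
  ring_nf

instance : Finite (RankOrdering N) := by
  have hfin := List.finite_length_le (Finset (Fin N)) (Fintype.card (Finset (Fin N)))
  have := hfin.to_subtype
  refine Finite.of_injective (β := {l : List (Finset (Fin N)) |
    l.length ≤ Fintype.card (Finset (Fin N))}) (fun R => ⟨R.classes, ?_⟩) ?_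
  · refine List.Nodup.length_le_card ?_
    refine (List.pairwise_iff_getElem.2 fun i j hi hj hij => ?_)
    intro he
    have h1 := List.pairwise_iff_getElem.1 R.disjoint i j hi hj hij
    rw [← he, disjoint_self_iff_empty] at h1
    exact (R.nonempty _ (List.getElem_mem hi)).ne_empty h1
  · rintro ⟨l, _, _, _⟩ ⟨l', _, _, _⟩ h
    simp only [Subtype.mk.injEq] at h
    subst h; rfl

theorem exists_family {F : Finset (Fin N) → Prop} (hF : UnionFamily F) :
    ∃ R : RankOrdering N, ∀ i, F (R.cum i) := by
  suffices h : ∃ R : RankOrdering N, ∀ C ∈ R.classes, C = univ by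
    obtain ⟨R, hR⟩ := h
    refine ⟨R, fun i => ?_⟩
    rcases (R.cum i).eq_empty_or_nonempty with he | ⟨k, hk⟩
    · rw [he]; exact hF.empty
    · obtain ⟨C, hC, -⟩ := R.mem_cum_iff_take.1 hk
      have : R.cum i = univ := eq_univ_iff_forall.2 fun j => R.mem_cum_iff_take.2
        ⟨C, hC, by rw [hR C (List.mem_of_mem_take hC)]; exact mem_univ j⟩
      rw [this]; exact hF.univ
  by_cases hN : (univ : Finset (Fin N)).Nonempty
  · exact ⟨⟨[univ], by simpa using hN, by simp, fun k => ⟨univ, by simp⟩⟩, by simp⟩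
  · exact ⟨⟨[], by simp, by simp, fun k => (hN ⟨k, mem_univ k⟩).elim⟩, by simp⟩

/-- Take an ordering of least area among the finitely many admissible ones. Refining lowers the area
or keeps it exactly when the penalty comparison does not favour the coarser ordering. -/
theorem exists_mem_familyCone {F : Finset (Fin N) → Prop} {f : ℕ → ℕ → ℝ} {G : ℕ → ℝ}
    (hG : Doubling G) (hF : UnionFamily F)
    (hf : ∀ m n, 0 < n → f m n = 1 / (G (m + n) - G m)) {Q : Fin N → ℝ} (hQ : ∀ k, 0 ≤ Q k) :
    ∃ R : RankOrdering N, (∀ i, F (R.cum i)) ∧ Q ∈ familyCone F f R := by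
  obtain ⟨R, hR, hmin⟩ := Set.exists_min_image {R : RankOrdering N | ∀ i, F (R.cum i)}
    -- Among orderings of equal area the one with most classes is taken, matching the tie-breaking
    -- rule in favour of refinements.
    (fun R => toLex (area G Q 0 0 R.classes, -(R.classes.length : ℤ))) (Set.toFinite _)
    (exists_family hF)
  have key : ∀ (R R' : RankOrdering N) (l₁ l₂ : List (Finset (Fin N))) (A B : Finset (Fin N)),
      R.classes = l₁ ++ (A ∪ B) :: l₂ → R'.classes = l₁ ++ A :: B :: l₂ →
      (f (#(R.cum l₁.length)) (#A) * ∑ k ∈ A, Q k ≤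
        f (#(R.cum l₁.length)) (#(A ∪ B)) * ∑ k ∈ A ∪ B, Q k ↔
      area G Q 0 0 R'.classes ≤ area G Q 0 0 R.classes) := by
    intro R R' l₁ l₂ A B h h'
    have hA : 0 < #A := card_pos.2 (R'.nonempty A (by simp [h']))
    have hAB : 0 < #(A ∪ B) := hA.trans_le (card_le_card subset_union_left)
    have h1 := hG.one_pos.trans_le
      (hG.gap (show #(R.cum l₁.length) < #(R.cum l₁.length) + #A by omega))
    have h2 := hG.one_pos.trans_le
      (hG.gap (show #(R.cum l₁.length) < #(R.cum l₁.length) + #(A ∪ B) by omega))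
    rw [← sub_nonpos (a := area G Q 0 0 R'.classes), area_refinement G Q h h', hf _ _ hA,
      hf _ _ hAB, one_div_mul_eq_div, one_div_mul_eq_div, div_le_div_iff₀ h1 h2, sub_nonpos,
      mul_comm, mul_comm (∑ k ∈ A ∪ B, Q k)]
  refine ⟨R, hR, hQ, fun R' hR' hadj => ?_⟩
  have h0 := hmin R' hR'
  rw [Prod.Lex.toLex_le_toLex] at h0
  rcases hadj with ⟨l₁, l₂, A, B, h, h'⟩ | ⟨l₁, l₂, A, B, h, h'⟩
  · rw [penalizesLess_refinement_iff h h', ← not_le, key R R' l₁ l₂ A B h h']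
    intro hle
    have hlen : R'.IsOneStepRefinement R := ⟨l₁, l₂, A, B, h, h'⟩
    have := hlen.length
    rcases h0 with h0 | h0
    · exact absurd h0 (not_lt.2 hle)
    · have := h0.2
      simp only at this
      omega
  · rw [penalizesLess_confinement_iff h h', key R' R l₁ l₂ A B h h']
    rcases h0 with h0 | h0
    exacts [h0.le, h0.1.le]

/-! ### Path-connected rank orderings -/

/-- Each node of `A` has a path to the destination inside `A`. -/
def ReachesWithin (net : Network N) (A : Finset (Fin N)) : Prop :=
  ∀ k ∈ A, ∃ l : List (Fin (N + 1)), List.IsChain net.Reaches (k.succ :: (l ++ [0])) ∧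
    ∀ j ∈ l, j = 0 ∨ ∃ k' ∈ A, j = Fin.succ k'

theorem ReachesWithin.union {net : Network N} {A B : Finset (Fin N)}
    (hA : ReachesWithin net A) (hB : ReachesWithin net B) : ReachesWithin net (A ∪ B) := by
  intro k hk
  rcases mem_union.1 hk with hk | hk
  · obtain ⟨l, h1, h2⟩ := hA k hk
    exact ⟨l, h1, fun j hj => (h2 j hj).imp_right
      fun ⟨k', h3, h4⟩ => ⟨k', mem_union_left _ h3, h4⟩⟩
  · obtain ⟨l, h1, h2⟩ := hB k hk
    exact ⟨l, h1, fun j hj => (h2 j hj).imp_right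
      fun ⟨k', h3, h4⟩ => ⟨k', mem_union_right _ h3, h4⟩⟩

theorem ReachesWithin.insert {net : Network N} {A : Finset (Fin N)} (hA : ReachesWithin net A)
    {k : Fin N} {j : Fin (N + 1)} (hkj : net.Reaches k.succ j)
    (hj : j = 0 ∨ ∃ k' ∈ A, j = Fin.succ k') : ReachesWithin net (insert k A) := by
  intro i hi
  rcases mem_insert.1 hi with rfl | hi
  · rcases hj with rfl | ⟨k', hk', rfl⟩
    · exact ⟨[], by simpa using hkj, by simp⟩
    · obtain ⟨l, h1, h2⟩ := hA k' hk'
      refine ⟨k'.succ :: l, by simpa using ⟨hkj, h1⟩, fun j hj => ?_⟩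
      rcases List.mem_cons.1 hj with rfl | hj
      · exact Or.inr ⟨k', mem_insert_of_mem hk', rfl⟩
      · exact (h2 j hj).imp_right fun ⟨k'', h3, h4⟩ => ⟨k'', mem_insert_of_mem h3, h4⟩
  · obtain ⟨l, h1, h2⟩ := hA i hi
    exact ⟨l, h1, fun j hj => (h2 j hj).imp_right
      fun ⟨k', h3, h4⟩ => ⟨k', mem_insert_of_mem h3, h4⟩⟩

theorem unionFamily_reachesWithin {net : Network N} (h : ReachesWithin net univ) :
    UnionFamily (ReachesWithin net) where
  empty := fun k hk => absurd hk (notMem_empty k)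
  univ := h
  union := fun _ _ => ReachesWithin.union

theorem reachesWithin_univ {net : Network N} (h : net.Connected) : ReachesWithin net univ := by
  intro k _
  obtain ⟨l, hl⟩ := h k.succ (Fin.succ_ne_zero k)
  refine ⟨l, hl, fun j _ => ?_⟩
  induction j using Fin.cases with
  | zero => exact Or.inl rfl
  | succ k' => exact Or.inr ⟨k', mem_univ _, rfl⟩

/-- Loops are cut from the back: if the head recurs in the shortened tail, continue from that
occurrence. -/
theorem exists_nodup_isChain {α : Type*} {r : α → α → Prop} {z : α} (l : List α) (i : α)
    (h : List.IsChain r (i :: (l ++ [z]))) :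
    ∃ l' : List α, l'.Nodup ∧ l' ⊆ l ∧ List.IsChain r (i :: (l' ++ [z])) := by
  induction l generalizing i with
  | nil => exact ⟨[], List.nodup_nil, List.Subset.refl _, h⟩
  | cons a t ih =>
    rw [List.cons_append, List.isChain_cons_cons] at h
    obtain ⟨l', hn, hs, hc⟩ := ih a h.2
    by_cases ha : a ∈ l'
    · obtain ⟨u, v, rfl⟩ := List.append_of_mem ha
      refine ⟨a :: v, (List.nodup_append.1 hn).2.1, ?_, ?_⟩
      · intro x hx
        rcases List.mem_cons.1 hx with rfl | hx
        · exact List.mem_cons_self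
        · exact List.mem_cons_of_mem _ (hs (by simp [hx]))
      · rw [List.cons_append, List.isChain_cons_cons]
        refine ⟨h.1, hc.suffix ⟨a :: u, ?_⟩⟩
        simp
    · refine ⟨a :: l', List.nodup_cons.2 ⟨ha, hn⟩, List.cons_subset_cons _ hs, ?_⟩
      rw [List.cons_append, List.isChain_cons_cons]
      exact ⟨h.1, hc⟩

theorem pathConnected_iff {net : Network N} {R : RankOrdering N} :
    R.PathConnected net ↔ ∀ i, ReachesWithin net (R.cum i) := by
  constructor
  · intro h i k hk
    obtain ⟨l, -, hl, hr⟩ := h k.succ (Fin.succ_ne_zero k)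
    refine ⟨l, hl, fun j hj => ?_⟩
    have h1 := hr j hj
    induction j using Fin.cases with
    | zero => exact Or.inl rfl
    | succ k' => exact Or.inr ⟨k', R.mem_cum.2 (h1.trans (R.mem_cum.1 hk)), rfl⟩
  · intro h i hi
    obtain ⟨k, rfl⟩ := Fin.exists_succ_eq.2 hi
    obtain ⟨l, hl, hr⟩ := h (R.rank k.succ) k (R.mem_cum.2 le_rfl)
    obtain ⟨l', hn, hs, hc⟩ := exists_nodup_isChain l _ hl
    refine ⟨l', hn, hc, fun j hj => ?_⟩
    rcases hr j (hs hj) with rfl | ⟨k', hk', rfl⟩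
    · exact Nat.zero_le _
    · exact R.mem_cum.1 hk'

theorem pathCone_eq (net : Network N) (f : ℕ → ℕ → ℝ) (R : RankOrdering N) :
    R.pathCone net f = R.familyCone (ReachesWithin net) f := by
  simp only [pathCone, familyCone, pathConnected_iff]

theorem cone_eq (f : ℕ → ℕ → ℝ) (R : RankOrdering N) :
    R.cone f = R.familyCone (fun _ => True) f := by
  simp [cone, familyCone]

theorem unionFamily_true : UnionFamily fun _ : Finset (Fin N) => True :=
  ⟨trivial, trivial, fun _ _ _ _ => trivial⟩

end RankOrdering

/-! ### Runs: measurability, independence, integrability -/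

/-- Intersections of events from `m₀` and `m₁` form a generating π-system on which the product
formula is immediate. It serves to combine the initial backlog with the earlier inputs. -/
theorem indep_sup_left {Ω : Type*} {m₀ m₁ m₂ mΩ : MeasurableSpace Ω} {P : Measure Ω}
    [IsProbabilityMeasure P] (h₀ : m₀ ≤ mΩ) (h₁ : m₁ ≤ mΩ) (h₂ : m₂ ≤ mΩ)
    (hi : Indep m₀ (m₁ ⊔ m₂) P) (hi' : Indep m₁ m₂ P) : Indep (m₀ ⊔ m₁) m₂ P := by
  set p : Set (Set Ω) := {u | ∃ a b, MeasurableSet[m₀] a ∧ MeasurableSet[m₁] b ∧ a ∩ b = u}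
  have hp : IsPiSystem p := by
    rintro _ ⟨a, b, ha, hb, rfl⟩ _ ⟨a', b', ha', hb', rfl⟩ -
    exact ⟨a ∩ a', b ∩ b', ha.inter ha', hb.inter hb', Set.inter_inter_inter_comm _ _ _ _⟩
  have hgen : m₀ ⊔ m₁ = MeasurableSpace.generateFrom p := by
    refine le_antisymm (sup_le (fun a ha => ?_) fun b hb => ?_)
      (MeasurableSpace.generateFrom_le ?_)
    · exact MeasurableSpace.measurableSet_generateFrom
        ⟨a, Set.univ, ha, MeasurableSet.univ, Set.inter_univ a⟩
    · exact MeasurableSpace.measurableSet_generateFrom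
        ⟨Set.univ, b, MeasurableSet.univ, hb, Set.univ_inter b⟩
    · rintro _ ⟨a, b, ha, hb, rfl⟩
      exact MeasurableSet.inter (le_sup_left (a := m₀) (b := m₁) a ha)
        (le_sup_right (a := m₀) (b := m₁) b hb)
  refine IndepSets.indep (sup_le h₀ h₁) h₂ hp (@MeasurableSpace.isPiSystem_measurableSet Ω m₂) hgen
    (@MeasurableSpace.generateFrom_measurableSet Ω m₂).symm ?_
  rw [IndepSets_iff]
  rintro _ c ⟨a, b, ha, hb, rfl⟩ hc
  have hc' : MeasurableSet[m₂] c := hc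
  have hb' : MeasurableSet[m₁ ⊔ m₂] b := le_sup_left (a := m₁) (b := m₂) b hb
  have hc'' : MeasurableSet[m₁ ⊔ m₂] c := le_sup_right (a := m₁) (b := m₂) c hc'
  rw [Indep_iff] at hi hi'
  rw [Set.inter_assoc, hi a (b ∩ c) ha (hb'.inter hc''), hi' b c hb hc', hi a b ha hb', mul_assoc]

/-- The queue dynamics as a function of backlogs, decisions and arrivals. -/
def nextBacklog {N : ℕ} (q : Fin (N + 1) → ℕ) (m : Fin (N + 1) → Fin (N + 1) → ℕ)
    (a : Fin N → ℕ) : Fin (N + 1) → ℕ :=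
  Fin.cases 0 fun k => (q k.succ - ∑ j, m k.succ j)
      + (∑ j, m j k.succ * if m j k.succ ≤ q j then 1 else 0) + a k

/-- Weighted backlogs change by the weighted arrivals and by the weight differences along which
packets are handed over. -/
theorem sum_mul_nextBacklog {N : ℕ} {q : Fin (N + 1) → ℕ} {m : Fin (N + 1) → Fin (N + 1) → ℕ}
    {a : Fin N → ℕ} (hq : q 0 = 0) (hm : ∀ i, ∑ j, m i j ≤ 1) {y : Fin (N + 1) → ℝ}
    (hy : y 0 = 0) :
    ∑ k : Fin N, y k.succ * ((nextBacklog q m a k.succ : ℝ) - q k.succ) =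
      ∑ k : Fin N, y k.succ * a k -
        ∑ k : Fin N, if q k.succ = 0 then 0 else ∑ j, m k.succ j * (y k.succ - y j) := by
  have hm1 : ∀ i j, m i j ≤ 1 := fun i j =>
    (single_le_sum (f := fun j => m i j) (fun _ _ => Nat.zero_le _) (mem_univ j)).trans (hm i)
  set u : Fin (N + 1) → Fin (N + 1) → ℝ := fun i j => if q i = 0 then 0 else (m i j : ℝ) with hu
  have hu0 : ∀ j, u 0 j = 0 := fun j => by simp [hu, hq]
  have hdelta : ∀ k : Fin N, (nextBacklog q m a k.succ : ℝ) - q k.succ =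
      a k - ∑ j, u k.succ j + ∑ j, u j k.succ := by
    intro k
    have h1 : ((q k.succ - ∑ j, m k.succ j : ℕ) : ℝ) = q k.succ - ∑ j, u k.succ j := by
      by_cases h : q k.succ = 0
      · simp [hu, h]
      · rw [Nat.cast_sub ((hm _).trans (Nat.one_le_iff_ne_zero.2 h))]
        simp [hu, h]
    have h2 : ∀ j, ((m j k.succ * if m j k.succ ≤ q j then 1 else 0 : ℕ) : ℝ) = u j k.succ := by
      intro j
      by_cases h : q j = 0
      · simp only [hu, h, if_true]
        by_cases h' : m j k.succ = 0 <;> simp [h']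
      · rw [if_pos ((hm1 _ _).trans (Nat.one_le_iff_ne_zero.2 h))]
        simp [hu, h]
    simp only [nextBacklog, Fin.cases_succ, Nat.cast_add, Nat.cast_sum]
    rw [h1, sum_congr rfl fun j _ => h2 j]
    ring
  have h1 : ∑ k : Fin N, y k.succ * (∑ j, u k.succ j - ∑ j, u j k.succ) =
      ∑ i, y i * (∑ j, u i j - ∑ j, u j i) := by
    rw [Fin.sum_univ_succ (fun i => y i * (∑ j, u i j - ∑ j, u j i)), hy, zero_mul, zero_add]
  have h2 : ∑ i, y i * (∑ j, u i j - ∑ j, u j i) = ∑ i, ∑ j, u i j * (y i - y j) := by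
    simp only [mul_sub, mul_sum, sum_sub_distrib]
    rw [sum_comm (f := fun i j => y i * u j i)]
    simp only [mul_comm]
  have h3 : ∑ i, ∑ j, u i j * (y i - y j) =
      ∑ k : Fin N, if q k.succ = 0 then 0 else ∑ j, m k.succ j * (y k.succ - y j) := by
    rw [Fin.sum_univ_succ (fun i => ∑ j, u i j * (y i - y j))]
    simp only [hu0, zero_mul, sum_const_zero, zero_add]
    refine sum_congr rfl fun k _ => ?_
    by_cases h : q k.succ = 0 <;> simp [hu, h]
  rw [← h3, ← h2, ← h1, ← sum_sub_distrib]
  refine sum_congr rfl fun k _ => ?_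
  rw [hdelta]; ring

theorem abs_nextBacklog_sub_le {N : ℕ} {q : Fin (N + 1) → ℕ}
    {m : Fin (N + 1) → Fin (N + 1) → ℕ} {a : Fin N → ℕ} (hm : ∀ i, ∑ j, m i j ≤ 1) (k : Fin N) :
    |(nextBacklog q m a k.succ : ℝ) - q k.succ| ≤ N + 1 + a k := by
  have hm1 : ∀ i j, m i j ≤ 1 := fun i j =>
    (single_le_sum (f := fun j => m i j) (fun _ _ => Nat.zero_le _) (mem_univ j)).trans (hm i)
  have h1 : ∑ j, (m j k.succ * if m j k.succ ≤ q j then 1 else 0) ≤ N + 1 := by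
    refine (sum_le_card_nsmul _ _ 1 fun j _ => ?_).trans (by simp)
    have := hm1 j k.succ
    split_ifs <;> omega
  have h2 := hm k.succ
  have h3 : nextBacklog q m a k.succ = (q k.succ - ∑ j, m k.succ j)
      + (∑ j, m j k.succ * if m j k.succ ≤ q j then 1 else 0) + a k := rfl
  have h4 : nextBacklog q m a k.succ ≤ q k.succ + (N + 1 + a k) := by omega
  have h5 : q k.succ ≤ nextBacklog q m a k.succ + (N + 1 + a k) := by omega
  have h4' : (nextBacklog q m a k.succ : ℝ) ≤ q k.succ + (N + 1 + a k) := by exact_mod_cast h4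
  have h5' : (q k.succ : ℝ) ≤ nextBacklog q m a k.succ + (N + 1 + a k) := by exact_mod_cast h5
  rw [abs_le]
  constructor <;> linarith

namespace Run

variable {N : ℕ} {net : Network N} {lam : Fin N → ℝ≥0} {Ω : Type u} [MeasurableSpace Ω]
  {P : Measure Ω} (run : Run net lam Ω P)

theorem Q_eq_nextBacklog (t : ℕ) (ω : Ω) :
    run.Q (t + 1) ω = nextBacklog (run.Q t ω) (run.mu t ω) (run.A t ω) := by
  ext i
  induction i using Fin.cases with
  | zero => rw [run.Q_dest]; rfl
  | succ k => rw [run.Q_succ]; rfl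

/-- The events determined by the initial backlog and by what happens before slot `t`. -/
@[reducible] def past (t : ℕ) : MeasurableSpace Ω :=
  MeasurableSpace.comap (run.Q 0) inferInstance ⊔
    ⨆ s ∈ Set.Iio t, MeasurableSpace.comap (fun ω => (run.A s ω, run.S s ω)) inferInstance

theorem past_mono {s t : ℕ} (h : s ≤ t) : run.past s ≤ run.past t :=
  sup_le_sup_left (biSup_mono fun _ hr => lt_of_lt_of_le hr h) _

theorem measurable_AS_past {s t : ℕ} (h : s < t) :
    Measurable[run.past t] (fun ω => (run.A s ω, run.S s ω)) := by
  refine Measurable.mono (comap_measurable _) ?_ le_rfl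
  exact (le_biSup (fun s => MeasurableSpace.comap (fun ω => (run.A s ω, run.S s ω)) inferInstance)
    (show s ∈ Set.Iio t from h)).trans le_sup_right

/-- Backlogs and decisions determine each other alternately, hence the joint induction. A decision
in slot s sees the forwarder sets of slot s and so belongs to `past (s + 1)`, not to `past s`. -/
theorem measurable_past (t : ℕ) :
    (∀ s, s ≤ t → Measurable[run.past s] (run.Q s)) ∧
      ∀ s, s < t → Measurable[run.past (s + 1)] (run.mu s) := by
  induction t with
  | zero =>
    refine ⟨fun s hs => ?_, fun s hs => by omega⟩
    obtain rfl : s = 0 := by omega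
    exact Measurable.mono (comap_measurable _) le_sup_left le_rfl
  | succ t ih =>
    have hmu : Measurable[run.past (t + 1)] (run.mu t) := by
      refine (run.adapted_mu t).mono (sup_le ?_ ?_) le_rfl
      · refine iSup₂_le fun s hs => Measurable.comap_le ?_
        refine Measurable.prodMk ((ih.1 s hs).mono (run.past_mono ?_) le_rfl) ?_
        · exact Nat.le_succ_of_le hs
        · exact measurable_snd.comp (run.measurable_AS_past (Nat.lt_succ_of_le hs))
      · refine iSup₂_le fun s hs => Measurable.comap_le ?_
        exact (ih.2 s hs).mono (run.past_mono (Nat.succ_le_succ (le_of_lt hs))) le_rfl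
    refine ⟨fun s hs => ?_, fun s hs => ?_⟩
    · rcases hs.lt_or_eq with hs | rfl
      · exact ih.1 s (by omega)
      · have h1 : Measurable[run.past (t + 1)] (run.Q t) :=
          (ih.1 t le_rfl).mono (run.past_mono t.le_succ) le_rfl
        have h2 : Measurable[run.past (t + 1)] (run.A t) :=
          measurable_fst.comp (run.measurable_AS_past t.lt_succ_self)
        have h3 : run.Q (t + 1) = (fun x : (Fin (N + 1) → ℕ) ×
            (Fin (N + 1) → Fin (N + 1) → ℕ) × (Fin N → ℕ) => nextBacklog x.1 x.2.1 x.2.2) ∘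
            fun ω => (run.Q t ω, run.mu t ω, run.A t ω) :=
          funext (run.Q_eq_nextBacklog t)
        rw [h3]
        exact Measurable.of_discrete.comp (h1.prodMk (hmu.prodMk h2))
    · rcases (Nat.lt_succ_iff.1 hs).lt_or_eq with hs | rfl
      exacts [ih.2 s hs, hmu]

theorem measurable_AS (t : ℕ) : Measurable fun ω => (run.A t ω, run.S t ω) :=
  (run.measurable_A t).prodMk (run.measurable_S t)

theorem past_le (t : ℕ) : run.past t ≤ ‹MeasurableSpace Ω› :=
  sup_le run.measurable_Q_zero.comap_le
    (iSup₂_le fun s _ => (run.measurable_AS s).comap_le)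

theorem measurable_Q (t : ℕ) : Measurable (run.Q t) :=
  ((run.measurable_past t).1 t le_rfl).mono (run.past_le t) le_rfl

theorem indepFun_Q [IsProbabilityMeasure P] (t : ℕ) :
    IndepFun (run.Q t) (fun ω => (run.A t ω, run.S t ω)) P := by
  set X := fun t ω => (run.A t ω, run.S t ω) with hX
  have hX' : ∀ s, MeasurableSpace.comap (X s) inferInstance ≤
      MeasurableSpace.comap (fun ω t => X t ω) inferInstance := fun s =>
    Measurable.comap_le ((measurable_pi_apply s).comp (comap_measurable (fun ω t => X t ω)))
  have h1 : Indep (⨆ s ∈ Set.Iio t, MeasurableSpace.comap (X s) inferInstance)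
      (MeasurableSpace.comap (X t) inferInstance) P := by
    have := indep_iSup_of_disjoint (fun s => (run.measurable_AS s).comap_le) run.indep
      (S := Set.Iio t) (T := {t}) (by simp)
    simpa using this
  have h2 : Indep (run.past t) (MeasurableSpace.comap (X t) inferInstance) P := by
    refine indep_sup_left run.measurable_Q_zero.comap_le
      (iSup₂_le fun s _ => (run.measurable_AS s).comap_le) (run.measurable_AS t).comap_le ?_ h1
    refine indep_of_indep_of_le_right run.indep_init ?_
    exact sup_le (iSup₂_le fun s _ => hX' s) (hX' t)
  exact indep_of_indep_of_le_left h2 ((run.measurable_past t).1 t le_rfl).comap_le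

theorem exists_backlog_le : ∃ c : ℝ, (∀ t ω k, (run.A t ω k : ℝ) ≤ c) ∧
    (∀ t ω k, |(run.Q (t + 1) ω k : ℝ) - run.Q t ω k| ≤ c) ∧
    ∀ t ω k, (run.Q t ω k : ℝ) ≤ run.Q 0 ω k + t * c := by
  obtain ⟨a, ha⟩ := run.bounded_A
  have ha' : ∀ t ω k, (run.A t ω k : ℝ) ≤ a := fun t ω k => by exact_mod_cast ha t ω k
  have h1 : ∀ t ω k, |(run.Q (t + 1) ω k : ℝ) - run.Q t ω k| ≤ N + 1 + a := by
    intro t ω k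
    induction k using Fin.cases with
    | zero => rw [run.Q_dest, run.Q_dest]; simp; positivity
    | succ k =>
      rw [run.Q_eq_nextBacklog]
      have := abs_nextBacklog_sub_le (q := run.Q t ω) (a := run.A t ω) (run.sum_mu_le t ω) k
      have := ha' t ω k
      linarith
  refine ⟨N + 1 + a, fun t ω k => (ha' t ω k).trans ?_, h1, fun t ω k => ?_⟩
  · have : (0 : ℝ) ≤ N := N.cast_nonneg
    linarith
  · induction t with
    | zero => simp
    | succ t ih =>
      have := (abs_le.1 (h1 t ω k)).2
      push_cast
      linarith

theorem memLp_Q [IsProbabilityMeasure P] (t : ℕ) (i : Fin (N + 1)) :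
    MemLp (fun ω => (run.Q t ω i : ℝ)) 2 P := by
  obtain ⟨c, -, -, hc⟩ := run.exists_backlog_le
  refine MemLp.of_le (g := fun ω => (run.Q 0 ω i : ℝ) + t * c)
    ((run.memLp_Q_zero i).add (memLp_const _)) ?_ (ae_of_all _ fun ω => ?_)
  · exact (measurable_from_top.comp
      ((measurable_pi_apply i).comp (run.measurable_Q t))).aestronglyMeasurable
  · have h1 := hc t ω i
    have h2 : (0 : ℝ) ≤ run.Q t ω i := Nat.cast_nonneg _
    rw [Real.norm_of_nonneg h2, Real.norm_of_nonneg (h2.trans h1)]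
    exact h1

theorem integrable_Q [IsProbabilityMeasure P] (t : ℕ) (i : Fin (N + 1)) :
    Integrable (fun ω => (run.Q t ω i : ℝ)) P :=
  (run.memLp_Q t i).integrable (by norm_num)

theorem integrable_A [IsProbabilityMeasure P] (t : ℕ) (k : Fin N) :
    Integrable (fun ω => (run.A t ω k : ℝ)) P := by
  obtain ⟨c, hc, -⟩ := run.exists_backlog_le
  refine Integrable.of_bound (C := c) (measurable_from_top.comp
      ((measurable_pi_apply k).comp (run.measurable_A t))).aestronglyMeasurable
      (ae_of_all _ fun ω => ?_)
  rw [Real.norm_of_nonneg (Nat.cast_nonneg _)]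
  exact hc t ω k

theorem integral_A (t : ℕ) (k : Fin N) : ∫ ω, (run.A t ω k : ℝ) ∂P = lam k := by
  rw [← run.rate_A k]
  have h : Measurable fun a : Fin N → ℕ => (a k : ℝ) := Measurable.of_discrete
  exact ((run.identDistrib_A t).comp h).integral_eq

theorem lintegral_Q [IsProbabilityMeasure P] (t : ℕ) (i : Fin (N + 1)) :
    ∫⁻ ω, (run.Q t ω i : ℝ≥0∞) ∂P = ENNReal.ofReal (∫ ω, (run.Q t ω i : ℝ) ∂P) := by
  rw [ofReal_integral_eq_lintegral_ofReal (run.integrable_Q t i)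
    (ae_of_all _ fun ω => Nat.cast_nonneg _)]
  simp

/-- Functions of the backlog and of a set of potential forwarders are averaged over the latter. -/
theorem integral_Q_S [IsProbabilityMeasure P] (t : ℕ) (i : Fin (N + 1))
    {g : (Fin (N + 1) → ℕ) → Finset (Fin (N + 1)) → ℝ}
    (hg : ∀ s, Integrable (fun ω => g (run.Q t ω) s) P) :
    Integrable (fun ω => g (run.Q t ω) (run.S t ω i)) P ∧
    ∫ ω, g (run.Q t ω) (run.S t ω i) ∂P =
      ∫ ω, ∑ s, (net.prob i s).toReal * g (run.Q t ω) s ∂P := by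
  have hSm : Measurable fun ω => run.S t ω i := (measurable_pi_apply i).comp (run.measurable_S t)
  have hset : ∀ s, MeasurableSet {ω | run.S t ω i = s} := fun s => hSm (measurableSet_singleton s)
  have hrepr : (fun ω => g (run.Q t ω) (run.S t ω i)) = fun ω =>
      ∑ s, g (run.Q t ω) s * (if run.S t ω i = s then 1 else 0) := by
    funext ω; simp
  have hind : ∀ s, IndepFun (fun ω => g (run.Q t ω) s)
      (fun ω => if run.S t ω i = s then (1 : ℝ) else 0) P := fun s =>
    (run.indepFun_Q t).comp (φ := fun q => g q s)
      (ψ := fun x : (Fin N → ℕ) × (Fin (N + 1) → Finset (Fin (N + 1))) =>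
        if x.2 i = s then (1 : ℝ) else 0) Measurable.of_discrete Measurable.of_discrete
  have hone : ∀ s, (fun ω => if run.S t ω i = s then (1 : ℝ) else 0) =
      {ω | run.S t ω i = s}.indicator 1 := by
    intro s; funext ω; simp [Set.indicator_apply]
  have hint : ∀ s, Integrable (fun ω => if run.S t ω i = s then (1 : ℝ) else 0) P := fun s => by
    rw [hone]; exact (integrable_const (1 : ℝ)).indicator (hset s)
  have hmul : ∀ s, Integrable
      (fun ω => g (run.Q t ω) s * (if run.S t ω i = s then 1 else 0)) P := fun s =>
    (hind s).integrable_mul (hg s) (hint s)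
  rw [hrepr]
  refine ⟨integrable_finsetSum _ fun s _ => hmul s, ?_⟩
  rw [integral_finsetSum _ fun s _ => hmul s,
    integral_finsetSum _ fun s _ => (hg s).const_mul _]
  refine sum_congr rfl fun s _ => ?_
  rw [(hind s).integral_fun_mul_eq_mul_integral (hg s).aestronglyMeasurable
    (hint s).aestronglyMeasurable, integral_const_mul, hone, integral_indicator_one (hset s),
    measureReal_def, run.law_S, mul_comm]

theorem integral_Q_A [IsProbabilityMeasure P] (t : ℕ) (k : Fin N)
    {g : (Fin (N + 1) → ℕ) → ℝ} (hg : Integrable (fun ω => g (run.Q t ω)) P) :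
    Integrable (fun ω => g (run.Q t ω) * run.A t ω k) P ∧
    ∫ ω, g (run.Q t ω) * run.A t ω k ∂P = ∫ ω, g (run.Q t ω) * lam k ∂P := by
  have hind : IndepFun (fun ω => g (run.Q t ω)) (fun ω => (run.A t ω k : ℝ)) P :=
    (run.indepFun_Q t).comp (φ := g)
      (ψ := fun x : (Fin N → ℕ) × (Fin (N + 1) → Finset (Fin (N + 1))) => (x.1 k : ℝ))
      Measurable.of_discrete Measurable.of_discrete
  refine ⟨hind.integrable_mul hg (run.integrable_A t k), ?_⟩
  rw [hind.integral_fun_mul_eq_mul_integral hg.aestronglyMeasurable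
    (run.integrable_A t k).aestronglyMeasurable, run.integral_A, integral_mul_const]

theorem stable_of_sum_le [IsProbabilityMeasure P]
    (h : ∀ k : Fin N, ∃ a b : ℝ, ∀ T : ℕ,
      ∑ t ∈ range T, ∫ ω, (run.Q t ω k.succ : ℝ) ∂P ≤ a + b * T) : run.Stable := by
  intro i
  induction i using Fin.cases with
  | zero => simp [run.Q_dest]
  | succ k =>
    obtain ⟨a, b, h⟩ := h k
    -- For T ≥ 1, a/T ≤ |a|.
    refine lt_of_le_of_lt (limsup_le_of_le (a := ENNReal.ofReal (|a| + b)) (by isBoundedDefault)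
      ?_) ENNReal.ofReal_lt_top
    filter_upwards [eventually_ge_atTop 1] with T hT
    have hT' : (1 : ℝ) ≤ T := by exact_mod_cast hT
    have hT0 : (0 : ℝ) < T := by linarith
    simp only [run.lintegral_Q]
    rw [← ENNReal.ofReal_sum_of_nonneg fun t _ => integral_nonneg fun ω => Nat.cast_nonneg _,
      ← ENNReal.ofReal_natCast, ← ENNReal.ofReal_div_of_pos hT0]
    refine ENNReal.ofReal_le_ofReal ?_
    rw [div_le_iff₀ hT0]
    have h1 := h T
    have h2 := le_abs_self a
    have h3 := mul_le_mul_of_nonneg_left hT' (abs_nonneg a)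
    linarith

theorem Stable.exists_sum_le [IsProbabilityMeasure P] {run : Run net lam Ω P} (h : run.Stable)
    (i : Fin (N + 1)) : ∃ b : ℝ, ∀ᶠ T : ℕ in atTop,
      ∑ t ∈ range T, ∫ ω, (run.Q t ω i : ℝ) ∂P ≤ b * T := by
  obtain ⟨b, hb, hbt⟩ := exists_between (h i)
  refine ⟨b.toReal, ?_⟩
  filter_upwards [eventually_lt_of_limsup_lt hb, eventually_ge_atTop 1] with T hT hT1
  have hT0 : (0 : ℝ) < T := by exact_mod_cast hT1
  simp only [run.lintegral_Q] at hT
  rw [← ENNReal.ofReal_sum_of_nonneg fun t _ => integral_nonneg fun ω => Nat.cast_nonneg _,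
    ← ENNReal.ofReal_natCast, ← ENNReal.ofReal_div_of_pos hT0] at hT
  have := (ENNReal.ofReal_le_iff_le_toReal hbt.ne).1 hT.le
  rwa [div_le_iff₀ hT0] at this

end Run

/-! ### Necessary condition for stabilizability -/

/-- The largest weight difference `y i - y j` over `j ∈ s ∪ {i}`. -/
noncomputable def maxDiff {N : ℕ} (y : Fin (N + 1) → ℝ) (i : Fin (N + 1))
    (s : Finset (Fin (N + 1))) : ℝ :=
  (insert i s).sup' (insert_nonempty _ _) fun j => y i - y j

/-- The largest expected drain of `∑ y_k Q_k` in a slot. -/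
noncomputable def capacity {N : ℕ} (net : Network N) (y : Fin (N + 1) → ℝ) : ℝ :=
  ∑ k : Fin N, ∑ s, (net.prob k.succ s).toReal * maxDiff y k.succ s

section MaxDiff

variable {N : ℕ} {y : Fin (N + 1) → ℝ} {i : Fin (N + 1)} {s : Finset (Fin (N + 1))}

theorem le_maxDiff {j : Fin (N + 1)} (hj : j ∈ s) : y i - y j ≤ maxDiff y i s :=
  le_sup' (fun j => y i - y j) (mem_insert_of_mem hj)

theorem maxDiff_nonneg : 0 ≤ maxDiff y i s :=
  (sub_self (y i)).symm.le.trans (le_sup' (fun j => y i - y j) (mem_insert_self i s))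

theorem maxDiff_le {c : ℝ} (hc : 0 ≤ c) (h : ∀ j ∈ s, y i - y j ≤ c) : maxDiff y i s ≤ c :=
  sup'_le _ _ fun j hj => by
    rcases mem_insert.1 hj with rfl | hj
    · simpa using hc
    · exact h j hj

theorem sum_mul_le_maxDiff {m : Fin (N + 1) → ℕ} (hm : ∀ j, m j ≤ if j ∈ s then 1 else 0)
    (hm1 : ∑ j, m j ≤ 1) : ∑ j, (m j : ℝ) * (y i - y j) ≤ maxDiff y i s := by
  have h1 : ∑ j, (m j : ℝ) * (y i - y j) ≤ ∑ j, (m j : ℝ) * maxDiff y i s := by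
    refine sum_le_sum fun j _ => ?_
    have := hm j
    split_ifs at this with hj
    · exact mul_le_mul_of_nonneg_left (le_maxDiff hj) (Nat.cast_nonneg _)
    · simp [Nat.le_zero.1 this]
  rw [← sum_mul, ← Nat.cast_sum] at h1
  have h2 : ((∑ j, m j : ℕ) : ℝ) ≤ 1 := by exact_mod_cast hm1
  have := mul_le_mul_of_nonneg_right h2 (maxDiff_nonneg (y := y) (i := i) (s := s))
  linarith

end MaxDiff

namespace Run

variable {N : ℕ} {net : Network N} {lam : Fin N → ℝ≥0} {Ω : Type u} [MeasurableSpace Ω]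
  {P : Measure Ω} [IsProbabilityMeasure P] (run : Run net lam Ω P)

theorem integral_sum_mul_Q (y : Fin (N + 1) → ℝ) (t : ℕ) :
    ∫ ω, ∑ k : Fin N, y k.succ * (run.Q t ω k.succ : ℝ) ∂P =
      ∑ k : Fin N, y k.succ * ∫ ω, (run.Q t ω k.succ : ℝ) ∂P := by
  rw [integral_finsetSum _ fun k _ => (run.integrable_Q t k.succ).const_mul _]
  simp only [integral_const_mul]

/-- Under any routing policy, weighted backlogs grow on average at least by the difference of the
weighted arrival rate and the largest drain. -/
theorem sum_mul_sub_capacity_le {y : Fin (N + 1) → ℝ} (hy : y 0 = 0) (t : ℕ) :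
    ∑ k : Fin N, y k.succ * lam k - capacity net y ≤
      ∑ k : Fin N, y k.succ * ∫ ω, (run.Q (t + 1) ω k.succ : ℝ) ∂P -
        ∑ k : Fin N, y k.succ * ∫ ω, (run.Q t ω k.succ : ℝ) ∂P := by
  have hS := fun k : Fin N => run.integral_Q_S t k.succ (g := fun _ s => maxDiff y k.succ s)
    fun s => integrable_const _
  have hA : ∀ k : Fin N, Integrable (fun ω => y k.succ * (run.A t ω k : ℝ)) P := fun k =>
    (run.integrable_A t k).const_mul _
  have hQ : ∀ t, Integrable (fun ω => ∑ k : Fin N, y k.succ * (run.Q t ω k.succ : ℝ)) P :=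
    fun t => integrable_finsetSum _ fun k _ => (run.integrable_Q t k.succ).const_mul _
  have h1 : ∫ ω, (∑ k : Fin N, y k.succ * (run.A t ω k : ℝ) -
      ∑ k : Fin N, maxDiff y k.succ (run.S t ω k.succ)) ∂P =
      ∑ k : Fin N, y k.succ * lam k - capacity net y := by
    rw [integral_sub (integrable_finsetSum _ fun k _ => hA k)
      (integrable_finsetSum _ fun k _ => (hS k).1), integral_finsetSum _ fun k _ => hA k,
      integral_finsetSum _ fun k _ => (hS k).1, capacity]
    congr 1
    · simp only [integral_const_mul, run.integral_A]
    · refine sum_congr rfl fun k _ => ?_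
      rw [(hS k).2]
      simp
  rw [← h1, ← run.integral_sum_mul_Q, ← run.integral_sum_mul_Q, ← integral_sub (hQ _) (hQ _)]
  refine integral_mono ((integrable_finsetSum _ fun k _ => hA k).sub
    (integrable_finsetSum _ fun k _ => (hS k).1)) ((hQ _).sub (hQ _)) fun ω => ?_
  dsimp only
  have h2 := sum_mul_nextBacklog (run.Q_dest t ω) (run.sum_mu_le t ω) (a := run.A t ω) hy
  rw [← run.Q_eq_nextBacklog] at h2
  simp only [mul_sub, sum_sub_distrib] at h2
  rw [h2]
  refine sub_le_sub_left (sum_le_sum fun k _ => ?_) _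
  split_ifs with h
  · exact maxDiff_nonneg
  · have := sum_mul_le_maxDiff (y := y) (i := k.succ) (run.mu_le t ω k.succ)
      (run.sum_mu_le t ω k.succ)
    simpa only [mul_sub, sum_sub_distrib] using this

end Run

/-- If the weighted rate exceeded the capacity by d > 0, the expected weighted backlog would be at
least d t in slot t, and its sum over time would grow quadratically, while stability permits only
linear growth. -/
theorem sum_mul_le_capacity {N : ℕ} {net : Network N} {lam : Fin N → ℝ≥0}
    (h : lam ∈ stabilityRegion net) {y : Fin (N + 1) → ℝ} (hy : y 0 = 0) (hy0 : ∀ i, 0 ≤ y i) :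
    ∑ k : Fin N, y k.succ * lam k ≤ capacity net y := by
  obtain ⟨Ω, _, P, _, run, hs⟩ := h
  by_contra! hlt
  set d := ∑ k : Fin N, y k.succ * lam k - capacity net y with hd
  have hd0 : 0 < d := sub_pos.2 hlt
  set V : ℕ → ℝ := fun t => ∑ k : Fin N, y k.succ * ∫ ω, (run.Q t ω k.succ : ℝ) ∂P with hV
  have hVt : ∀ t : ℕ, d * t ≤ V t := by
    intro t
    induction t with
    | zero =>
      simp only [CharP.cast_eq_zero, mul_zero]
      exact sum_nonneg fun k _ => mul_nonneg (hy0 _) (integral_nonneg fun ω => Nat.cast_nonneg _)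
    | succ t ih =>
      have := run.sum_mul_sub_capacity_le hy t
      push_cast
      linarith
  have hsumV : ∀ T : ℕ, d * ((T : ℝ) * (T - 1) / 2) ≤ ∑ t ∈ range T, V t := by
    intro T
    induction T with
    | zero => simp
    | succ T ih =>
      rw [sum_range_succ]
      have := hVt T
      push_cast
      linarith
  choose b hb using fun k : Fin N => hs.exists_sum_le k.succ
  have hev : ∀ᶠ T : ℕ in atTop, ∑ t ∈ range T, V t ≤ (∑ k : Fin N, y k.succ * b k) * T := by
    filter_upwards [eventually_all.2 hb] with T hT
    simp only [hV]
    rw [sum_comm, sum_mul]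
    refine sum_le_sum fun k _ => ?_
    rw [← mul_sum, mul_assoc]
    exact mul_le_mul_of_nonneg_left (hT k) (hy0 _)
  obtain ⟨T, hT, hT1, hT2⟩ := (hev.and ((eventually_ge_atTop 1).and
    (tendsto_natCast_atTop_atTop.eventually_gt_atTop
      (2 * (∑ k : Fin N, y k.succ * b k) / d + 1)))).exists
  have h1 := (hsumV T).trans hT
  have hT0 : (0 : ℝ) < T := by exact_mod_cast hT1
  have h2 : d * ((T - 1) / 2) ≤ ∑ k : Fin N, y k.succ * b k := by
    refine le_of_mul_le_mul_right (le_trans (le_of_eq ?_) h1) hT0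
    ring
  have h3 : 2 * (∑ k : Fin N, y k.succ * b k) / d < T - 1 := by linarith
  rw [div_lt_iff₀ hd0] at h3
  linarith

theorem exists_add_mem_of_mem_interior {N : ℕ} {s : Set (Fin N → ℝ≥0)} {lam : Fin N → ℝ≥0}
    (h : lam ∈ interior s) : ∃ ε : ℝ≥0, 0 < ε ∧ (fun k => lam k + ε) ∈ s := by
  have hc : Continuous fun ε : ℝ≥0 => fun k => lam k + ε := by fun_prop
  have h0 : (fun k => lam k + 0) ∈ interior s := by simpa using h
  have h1 := (hc.tendsto 0).eventually (isOpen_interior.mem_nhds h0)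
  obtain ⟨ε, hε, hpos⟩ := ((h1.filter_mono nhdsWithin_le_nhds).and
    (self_mem_nhdsWithin (s := Set.Ioi (0 : ℝ≥0)))).exists
  exact ⟨ε, hpos, interior_subset hε⟩

/-! ### Priority-based routing is throughput optimal -/

namespace RankOrdering

variable {N : ℕ}

/-- With weights monotone in rank, a forwarder of lowest rank also has least weight, whichever way
ties are broken. -/
theorem IsPriorityDecision.sum_eq_maxDiff {R : RankOrdering N}
    {s : Fin (N + 1) → Finset (Fin (N + 1))} {m : Fin (N + 1) → Fin (N + 1) → ℕ}
    (h : R.IsPriorityDecision s m) {y : Fin (N + 1) → ℝ}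
    (hy : ∀ i j, R.rank i ≤ R.rank j → y i ≤ y j) {i : Fin (N + 1)} (hi : i ≠ 0)
    (his : i ∈ s i) (hm : ∀ j, m i j ≤ if j ∈ s i then 1 else 0) :
    ∑ j, (m i j : ℝ) * (y i - y j) = maxDiff y i (s i) := by
  obtain ⟨h1, h2⟩ := h i hi
  refine le_antisymm (sum_mul_le_maxDiff hm h1.le) ?_
  have h3 : ∀ j, (m i j : ℝ) * maxDiff y i (s i) ≤ m i j * (y i - y j) := by
    intro j
    have hj := hm j
    by_cases hj1 : m i j = 1
    · rw [hj1, Nat.cast_one, one_mul, one_mul]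
      obtain ⟨-, hmin⟩ := h2 j hj1
      refine maxDiff_le (sub_nonneg.2 (hy j i (hmin i his))) fun k hk => ?_
      exact sub_le_sub_left (hy j k (hmin k hk)) _
    · have : m i j = 0 := by split_ifs at hj <;> omega
      simp [this]
  have h4 := sum_le_sum fun j (_ : j ∈ (univ : Finset (Fin (N + 1)))) => h3 j
  rw [← sum_mul, ← Nat.cast_sum, h1, Nat.cast_one, one_mul] at h4
  exact h4

end RankOrdering

namespace Run

variable {N : ℕ} {net : Network N} {lam : Fin N → ℝ≥0} {Ω : Type u} [MeasurableSpace Ω]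
  {P : Measure Ω} [IsProbabilityMeasure P] (run : Run net lam Ω P)

theorem integrable_lyapunov {F : Finset (Fin N) → Prop} {G : ℕ → ℝ} (hG : Doubling G)
    (hF : UnionFamily F) (t : ℕ) :
    Integrable (fun ω => lyapunov F G fun k => (run.Q t ω k.succ : ℝ)) P := by
  have hsq : Integrable (fun ω => (∑ k : Fin N, (run.Q t ω k.succ : ℝ)) ^ 2 / G 1) P :=
    ((memLp_finsetSum _ fun k _ => run.memLp_Q t k.succ).integrable_sq).div_const _
  refine hsq.mono' ?_ (ae_of_all _ fun ω => ?_)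
  · have h : Measurable fun q : Fin (N + 1) → ℕ => lyapunov F G fun k => (q k.succ : ℝ) :=
      Measurable.of_discrete
    exact (h.comp (run.measurable_Q t)).aestronglyMeasurable
  · have h0 : ∀ k : Fin N, (0 : ℝ) ≤ run.Q t ω k.succ := fun k => Nat.cast_nonneg _
    rw [Real.norm_of_nonneg (lyapunov_nonneg hG h0)]
    exact lyapunov_le_sq hG hF h0

/-- Foster-Lyapunov argument common to both policies. The hypothesis `hins` is what makes empty
queues harmless. -/
theorem stable_of_priority {F : Finset (Fin N) → Prop} {G : ℕ → ℝ} {f : ℕ → ℕ → ℝ}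
    (hG : Doubling G) (hF : UnionFamily F)
    (hf : ∀ m n, 0 < n → f m n = 1 / (G (m + n) - G m))
    (hins : ∀ A, F A → ∀ (k : Fin N) (j : Fin (N + 1)), net.Reaches k.succ j →
      (j = 0 ∨ ∃ k' ∈ A, j = Fin.succ k') → F (insert k A))
    (hlam : lam ∈ interior (stabilityRegion net))
    (hrun : ∀ t ω, ∃ R : RankOrdering N, (∀ i, F (R.cum i)) ∧
      (fun k : Fin N => (run.Q t ω k.succ : ℝ)) ∈ R.familyCone F f ∧
      R.IsPriorityDecision (run.S t ω) (run.mu t ω)) : run.Stable := by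
  obtain ⟨ε, hε, hreg⟩ := exists_add_mem_of_mem_interior hlam
  have hex : ∀ q : Fin (N + 1) → ℕ, ∃ y : Fin N → ℝ, IsSlope F G (fun k => (q k.succ : ℝ)) y := by
    intro q
    obtain ⟨R, hR, hRQ⟩ := RankOrdering.exists_mem_familyCone hG hF hf
      (Q := fun k : Fin N => (q k.succ : ℝ)) fun k => Nat.cast_nonneg _
    exact ⟨_, RankOrdering.isSlope_slope hG hF hf hR hRQ⟩
  -- The slope is chosen as a function of the backlog alone, so it is independent of the current
  -- arrivals and channels.
  choose y hy using hex
  set z : (Fin (N + 1) → ℕ) → Fin (N + 1) → ℝ := fun q => Fin.cases 0 (y q) with hz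
  have hz0 : ∀ q, z q 0 = 0 := fun q => rfl
  have hzs : ∀ q k, z q (Fin.succ k) = y q k := fun q k => rfl
  have hznn : ∀ q i, 0 ≤ z q i := by
    intro q i
    induction i using Fin.cases with
    | zero => exact le_rfl
    | succ k => exact (hy q).nonneg k
  -- nodes with empty queues have no neighbours of smaller weight
  have hempty : ∀ q (k : Fin N), q k.succ = 0 → ∀ s, 0 < net.prob k.succ s →
      maxDiff (z q) k.succ s = 0 := by
    intro q k hk s hs
    refine le_antisymm (maxDiff_le le_rfl fun j hj => sub_nonpos.2 ?_) maxDiff_nonneg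
    rw [hzs]
    refine (hy q).le_of_insert hG (by simp [hk]) (hznn q j) fun c hc => ?_
    refine hins _ ((hy q).mem c ((hznn q j).trans hc)) k j ⟨s, hj, hs⟩ ?_
    induction j using Fin.cases with
    | zero => exact Or.inl rfl
    | succ k' => exact Or.inr ⟨k', mem_levelSet.2 hc, rfl⟩
  obtain ⟨c, -, hcQ, -⟩ := run.exists_backlog_le
  set δ : ℝ := N * c
  set B : ℝ := Fintype.card (Finset (Fin N) × Finset (Fin N)) * (δ * (2 * (δ / G 1)))
  set L : (Fin (N + 1) → ℕ) → ℝ := fun q => lyapunov F G fun k => (q k.succ : ℝ) with hL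
  set g : Fin N → (Fin (N + 1) → ℕ) → Finset (Fin (N + 1)) → ℝ := fun k q s =>
    if q k.succ = 0 then 0 else maxDiff (z q) k.succ s with hg
  have hdrift : ∀ t ω, L (run.Q (t + 1) ω) ≤ L (run.Q t ω) +
      (∑ k, y (run.Q t ω) k * run.A t ω k - ∑ k, g k (run.Q t ω) (run.S t ω k.succ)) + B := by
    intro t ω
    have h1 := lyapunov_le_add hG hF (Q' := fun k : Fin N => (run.Q (t + 1) ω k.succ : ℝ))
      (fun k => Nat.cast_nonneg _) (fun k => Nat.cast_nonneg _) (hy (run.Q t ω)) (δ := δ) (by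
        refine (sum_le_card_nsmul _ _ c fun k _ => hcQ t ω k.succ).trans ?_
        simp [δ])
    have h2 := sum_mul_nextBacklog (run.Q_dest t ω) (run.sum_mu_le t ω) (a := run.A t ω)
      (hz0 (run.Q t ω))
    rw [← run.Q_eq_nextBacklog] at h2
    simp only [hzs] at h2
    rw [h2] at h1
    refine h1.trans (le_of_eq ?_)
    congr 3
    refine sum_congr rfl fun k _ => ?_
    simp only [hg]
    split_ifs with hk
    · rfl
    obtain ⟨R, hR, hRQ, hpr⟩ := hrun t ω
    refine hpr.sum_eq_maxDiff (y := z (run.Q t ω)) (fun i j hij => ?_) (Fin.succ_ne_zero k)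
      (run.self_mem_S t ω _) (run.mu_le t ω _)
    induction i using Fin.cases with
    | zero => exact hznn _ j
    | succ i =>
      induction j using Fin.cases with
      | zero =>
        obtain ⟨a, -, ha⟩ := R.rank_succ i
        rw [ha, R.rank_zero] at hij
        omega
      | succ j =>
        rw [hzs, hzs, (hy (run.Q t ω)).unique hG hF (fun k => Nat.cast_nonneg _)
          (RankOrdering.isSlope_slope hG hF hf hR hRQ)]
        exact RankOrdering.slope_le_slope hG hf hR hRQ hij
  have hyint : ∀ t k, Integrable (fun ω => y (run.Q t ω) k) P := by
    intro t k
    have hb : Integrable (fun ω => (∑ k : Fin N, (run.Q t ω k.succ : ℝ)) / G 1) P :=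
      (integrable_finsetSum _ fun k _ => run.integrable_Q t k.succ).div_const _
    refine hb.mono' ?_ (ae_of_all _ fun ω => ?_)
    · have h : Measurable fun q : Fin (N + 1) → ℕ => y q k := Measurable.of_discrete
      exact (h.comp (run.measurable_Q t)).aestronglyMeasurable
    · rw [Real.norm_of_nonneg ((hy _).nonneg k)]
      exact (hy _).le_div hG hF (fun k => Nat.cast_nonneg _) k
  have hmint : ∀ t (k : Fin N) s,
      Integrable (fun ω => maxDiff (z (run.Q t ω)) k.succ s) P := by
    intro t k s
    refine (hyint t k).mono' ?_ (ae_of_all _ fun ω => ?_)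
    · have h : Measurable fun q : Fin (N + 1) → ℕ => maxDiff (z q) k.succ s :=
        Measurable.of_discrete
      exact (h.comp (run.measurable_Q t)).aestronglyMeasurable
    · rw [Real.norm_of_nonneg maxDiff_nonneg]
      refine maxDiff_le ((hy _).nonneg k) fun j _ => ?_
      rw [hzs]
      exact sub_le_self _ (hznn _ j)
  have hgint : ∀ t k s, Integrable (fun ω => g k (run.Q t ω) s) P := by
    intro t k s
    refine (hmint t k s).mono ?_ (ae_of_all _ fun ω => ?_)
    · have h : Measurable fun q : Fin (N + 1) → ℕ => g k q s := Measurable.of_discrete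
      exact (h.comp (run.measurable_Q t)).aestronglyMeasurable
    · simp only [hg]
      split_ifs <;> simp
  have hLint : ∀ t, Integrable (fun ω => L (run.Q t ω)) P := run.integrable_lyapunov hG hF
  have hA := fun t k => run.integral_Q_A t k (g := fun q => y q k) (hyint t k)
  have hS := fun t (k : Fin N) => run.integral_Q_S t k.succ (g := g k) (hgint t k)
  have hAsum := fun t => integrable_finsetSum univ fun k (_ : k ∈ univ) => (hA t k).1
  have hSsum := fun t => integrable_finsetSum univ fun k (_ : k ∈ univ) => (hS t k).1
  -- The summand 1 keeps κ positive even for N = 0, where G(0) = 0.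
  set κ : ℝ := G (Fintype.card (Fin N)) + 1
  have hκ : 0 < κ := by have := hG.nonneg (Fintype.card (Fin N)); positivity
  have hQκ : ∀ q (k : Fin N), (q k.succ : ℝ) ≤ κ * y q k := fun q k => by
    have h1 := (hy q).le_mul hG hF (fun k => Nat.cast_nonneg _) k
    have h2 := (hy q).nonneg k
    simp only [κ, add_mul]
    linarith
  -- The drain under the policy equals the full capacity, because empty queues contribute nothing to
  -- it; the capacity bound at λ + ε then leaves a surplus ε ∑ y_k.
  have hpoint : ∀ q : Fin (N + 1) → ℕ, ∑ k, y q k * lam k -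
      ∑ k : Fin N, ∑ s, (net.prob k.succ s).toReal * g k q s ≤
        -(ε / κ * ∑ k : Fin N, (q k.succ : ℝ)) := by
    intro q
    have h1 := sum_mul_le_capacity hreg (hz0 q) (hznn q)
    have h2 : capacity net (z q) = ∑ k : Fin N, ∑ s, (net.prob k.succ s).toReal * g k q s := by
      refine sum_congr rfl fun k _ => sum_congr rfl fun s _ => ?_
      simp only [hg]
      split_ifs with hk
      · rcases eq_or_ne (net.prob k.succ s) 0 with h0 | h0
        · simp [h0]
        · rw [hempty q k hk s (pos_iff_ne_zero.2 h0)]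
      · rfl
    rw [h2] at h1
    simp only [hzs, NNReal.coe_add, mul_add, sum_add_distrib] at h1
    have h3 : ε / κ * ∑ k : Fin N, (q k.succ : ℝ) ≤ ∑ k, y q k * ε := by
      rw [mul_sum]
      refine sum_le_sum fun k _ => ?_
      have := mul_le_mul_of_nonneg_left (hQκ q k)
        (div_nonneg ε.coe_nonneg hκ.le : (0 : ℝ) ≤ ε / κ)
      refine this.trans (le_of_eq ?_)
      field_simp
    linarith
  have hstep : ∀ t, ε / κ * ∑ k : Fin N, ∫ ω, (run.Q t ω k.succ : ℝ) ∂P ≤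
      ∫ ω, L (run.Q t ω) ∂P - ∫ ω, L (run.Q (t + 1) ω) ∂P + B := by
    intro t
    have h1 := integral_mono (hLint (t + 1))
      (((hLint t).add ((hAsum t).sub (hSsum t))).add (integrable_const B)) (hdrift t)
    have he1 := integral_add ((hLint t).add ((hAsum t).sub (hSsum t))) (integrable_const B)
    have he2 := integral_add (hLint t) ((hAsum t).sub (hSsum t))
    simp only [Pi.add_apply, Pi.sub_apply] at h1 he1 he2
    rw [he1, he2, integral_sub (hAsum t) (hSsum t), integral_finsetSum _ fun k _ => (hA t k).1,
      integral_finsetSum _ fun k _ => (hS t k).1, sum_congr rfl fun k _ => (hA t k).2,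
      sum_congr rfl fun k _ => (hS t k).2] at h1
    have hyl : ∀ k ∈ univ, Integrable (fun ω => y (run.Q t ω) k * (lam k : ℝ)) P :=
      fun k _ => (hyint t k).mul_const _
    have hgl : ∀ k ∈ univ, Integrable
        (fun ω => ∑ s, (net.prob (Fin.succ k) s).toReal * g k (run.Q t ω) s) P :=
      fun k _ => integrable_finsetSum _ fun s _ => (hgint t k s).const_mul _
    have hql : Integrable (fun ω => ∑ k : Fin N, (run.Q t ω k.succ : ℝ)) P :=
      integrable_finsetSum _ fun k _ => run.integrable_Q t k.succ
    rw [← integral_finsetSum _ hyl, ← integral_finsetSum _ hgl,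
      ← integral_sub (integrable_finsetSum _ hyl) (integrable_finsetSum _ hgl)] at h1
    have h2 := integral_mono ((integrable_finsetSum _ hyl).sub (integrable_finsetSum _ hgl))
      (hql.const_mul (ε / κ : ℝ)).neg fun ω => hpoint (run.Q t ω)
    simp only [Pi.sub_apply, Pi.neg_apply] at h2
    rw [integral_neg, integral_const_mul,
      integral_finsetSum _ fun k _ => run.integrable_Q t k.succ] at h2
    simp only [integral_const, probReal_univ, one_smul] at h1
    linarith
  have hsum : ∀ T : ℕ, ∑ t ∈ range T, (ε / κ * ∑ k : Fin N, ∫ ω, (run.Q t ω k.succ : ℝ) ∂P) ≤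
      ∫ ω, L (run.Q 0 ω) ∂P - ∫ ω, L (run.Q T ω) ∂P + B * T := by
    intro T
    induction T with
    | zero => simp
    | succ T ih =>
      rw [sum_range_succ]
      have := hstep T
      push_cast
      linarith
  have hεκ : (0 : ℝ) < ε / κ := div_pos (NNReal.coe_pos.2 hε) hκ
  refine run.stable_of_sum_le fun k => ⟨(∫ ω, L (run.Q 0 ω) ∂P) / (ε / κ), B / (ε / κ),
    fun T => ?_⟩
  have h1 := hsum T
  have h2 : 0 ≤ ∫ ω, L (run.Q T ω) ∂P :=
    integral_nonneg fun ω => lyapunov_nonneg hG fun k => Nat.cast_nonneg _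
  rw [← mul_sum] at h1
  have h3 : ∑ t ∈ range T, ∫ ω, (run.Q t ω k.succ : ℝ) ∂P ≤
      ∑ t ∈ range T, ∑ k : Fin N, ∫ ω, (run.Q t ω k.succ : ℝ) ∂P :=
    sum_le_sum fun t _ => single_le_sum
      (f := fun k : Fin N => ∫ ω, (run.Q t ω k.succ : ℝ) ∂P)
      (fun k _ => integral_nonneg fun ω => Nat.cast_nonneg _) (mem_univ k)
  have h4 := mul_le_mul_of_nonneg_left h3 hεκ.le
  rw [div_mul_eq_mul_div, ← add_div, le_div_iff₀ hεκ]
  linarith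

end Run

theorem theorem1 {N : ℕ} (net : Network N) (f : ℕ → ℕ → ℝ)
    (hpos : ∀ m n, 0 < n → 0 < f m n)
    (hC1 : ∀ m n₁ n₂, 0 < n₁ → 0 < n₂ → 1 / f m (n₁ + n₂) = 1 / f m n₁ + 1 / f (m + n₁) n₂)
    (hC2 : ∀ m n₁ n₂, 0 < n₁ → 0 < n₂ → f (m + n₁) n₂ ≤ f m n₁) :
    ((∀ Q : Fin N → ℝ, (∀ k, 0 ≤ Q k) → ∃ R : RankOrdering N, Q ∈ R.cone f) ∧
      ThroughputOptimal.{u} net (fPolicy f)) ∧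
    ((net.Connected → ∀ Q : Fin N → ℝ, (∀ k, 0 ≤ Q k) →
        ∃ R : RankOrdering N, R.PathConnected net ∧ Q ∈ R.pathCone net f) ∧
      ThroughputOptimal.{u} net (pathConnectedFPolicy net f)) := by
  have hG := doubling_cumWeight hC1 hpos hC2
  have hf := eq_one_div_cumWeight_sub hC1
  refine ⟨⟨fun Q hQ => ?_, ?_⟩, fun hnet Q hQ => ?_, ?_⟩
  · obtain ⟨R, -, hR⟩ :=
      RankOrdering.exists_mem_familyCone hG RankOrdering.unionFamily_true hf hQ
    exact ⟨R, by rwa [RankOrdering.cone_eq]⟩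
  · intro lam hlam Ω _ P _ run hrun
    refine run.stable_of_priority hG RankOrdering.unionFamily_true hf
      (fun _ _ _ _ _ _ => trivial) hlam fun t ω => ?_
    obtain ⟨R, hR, hpr⟩ := hrun t ω
    rw [RankOrdering.cone_eq] at hR
    exact ⟨R, fun _ => trivial, hR, hpr⟩
  · obtain ⟨R, hR, hRQ⟩ := RankOrdering.exists_mem_familyCone hG
      (RankOrdering.unionFamily_reachesWithin (RankOrdering.reachesWithin_univ hnet)) hf hQ
    exact ⟨R, RankOrdering.pathConnected_iff.2 hR, by rwa [RankOrdering.pathCone_eq]⟩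
  · intro lam hlam Ω _ P _ run hrun
    -- Connectedness is not assumed here; it follows from the path-connected ordering that the
    -- policy uses in slot 0 at any sample point.
    have huniv : RankOrdering.ReachesWithin net univ := by
      obtain ⟨ω⟩ := nonempty_of_isProbabilityMeasure P
      obtain ⟨R, hR, -⟩ := hrun 0 ω
      rw [← R.cum_eq_univ le_rfl]
      exact RankOrdering.pathConnected_iff.1 hR _
    refine run.stable_of_priority hG (RankOrdering.unionFamily_reachesWithin huniv) hf
      (fun A hA k j hkj hj => hA.insert hkj hj) hlam fun t ω => ?_
    obtain ⟨R, hR, hRQ, hpr⟩ := hrun t ω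
    rw [RankOrdering.pathCone_eq] at hRQ
    exact ⟨R, RankOrdering.pathConnected_iff.1 hR, hRQ, hpr⟩
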